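/- Let $R$ be an associative unital ring with Jacobson radical $J(R)$, and suppose that $R$ is semiperfect, i.e. $\mathrm{top}(R):=R/J(R)$ is a semisimple ring and idempotents lift modulo $J(R)$. Notation. Let $S_r=\mathrm{soc}(R_R)$ and $S_l=\mathrm{soc}({}_RR)$ be the right and the left socle (the sums of the simple right, respectively left, ideals). For a module $M$ let $\mathrm{soc}(M)$ be the sum of its simple submodules and $\mathrm{top}(M)=M/\mathrm{rad}(M)$, where $\mathrm{rad}(M)$ is the intersection of the maximal submodules of $M$. Write ${}_R\mathcal L(M)$ and $\mathcal L_R(M)$ for the lattices of left and of right submodules. For $X\subseteq R$ put $l(X)=\{a\in R: aX=0\}$ and $r(X)=\{a\in R: Xa=0\}$. A right ideal $I$ is a right D-ideal if $rl(I)=I$; a left ideal $I'$ is a left D-ideal if $lr(I')=I'$. The ring $R$ is Kasch if every simple right module is isomorphic to a right ideal and every simple left module is isomorphic to a left ideal; it is a minannihilator ring if all simple right ideals are right D-ideals and all simple left ideals are left D-ideals. An idempotent $e$ is local if $\mathrm{End}_R(eR)$ is a local ring. A basic set of idempotents of $R$ is a list $e_1,\dots,e_n$ of distinct members of a finite family $\varepsilon_1,\dots,\varepsilon_m$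 of pairwise orthogonal local idempotents with $\varepsilon_1+\dots+\varepsilon_m=1$, such that every $\varepsilon_jR$ is isomorphic to $e_kR$ for exactly one $k$. A permutation $\pi$ of $\{1,\dots,n\}$ is a Nakayama permutation of $R$ (with respect to $e_1,\dots,e_n$) if for every $k$ $$\mathrm{soc}(e_kR)\cong\mathrm{top}(e_{\pi(k)}R)\quad\text{and}\quad \mathrm{soc}(Re_{\pi(k)})\cong\mathrm{top}(Re_k).$$ Theorem. The semiperfect ring $R$ has a basic set of idempotents, and for every basic set $e_1,\dots,e_n$ of idempotents of $R$ the following are equivalent: (1) $R$ has a Nakayama permutation (with respect to $e_1,\dots,e_n$) and $S_l=S_r$. (2) $R$ is a Kasch minannihilator ring. (3) All right ideals contained in $S_r$ and all right ideals containing $J(R)$ are right D-ideals, and all left ideals contained in $S_l$ and all left ideals containing $J(R)$ are left D-ideals. (4) The maps $l$ and $r$ induce mutually inverse lattice anti-isomorphisms $${}_R\mathcal L(\mathrm{top}(R))\cong_{op}\mathcal L_R(S_r)\quad\text{and}\quad {}_R\mathcal L(S_l)\cong_{op}\mathcal L_R(\mathrm{top}(R)),$$ where a one-sided submodule of $\mathrm{top}(R)=R/J(R)$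 is identified with its preimage in $R$. -/

import Mathlib

/-!
Conventions. For a ring `R`, left modules are `Module R M` and right modules are `Module Rᵐᵒᵖ M`.
Left ideals are `Ideal R = Submodule R R`; right ideals are `Submodule Rᵐᵒᵖ R`.
-/

open MulOpposite

universe u

section Modules

variable (A : Type*) [Ring A] (M : Type*) [AddCommGroup M] [Module A M]

/-- The socle of a module: the sum of its simple submodules. -/
def moduleSocle : Submodule A M :=
  sSup {N : Submodule A M | IsSimpleModule A N}

/-- The top of a module: its quotient by its radical (the intersection of the maximal
submodules). -/
abbrev ModuleTop : Type _ := M ⧸ Module.jacobson A M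

end Modules

section Rings

variable (R : Type u) [Ring R]

/-- A ring is semiperfect if it is semilocal (`R / J(R)` is a semisimple ring) and idempotents
lift modulo the Jacobson radical `J(R)`. -/
def IsSemiperfectRing : Prop :=
  IsSemisimpleRing (R ⧸ Ring.jacobson R) ∧
    ∀ x : R ⧸ Ring.jacobson R, IsIdempotentElem x →
      ∃ e : R, IsIdempotentElem e ∧ Ideal.Quotient.mk (Ring.jacobson R) e = x

/-- The Jacobson radical `J(R)`, a two-sided ideal, regarded as a right ideal. -/
def jacobsonRight : Submodule Rᵐᵒᵖ R where
  carrier := (Ring.jacobson R : Set R)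
  add_mem' := fun ha hb => (Ring.jacobson R).add_mem ha hb
  zero_mem' := (Ring.jacobson R).zero_mem
  smul_mem' := fun c _ hx => Ideal.mul_mem_right (unop c) (Ring.jacobson R) hx

/-- The left socle `S_l`. -/
def leftSocle : Ideal R := moduleSocle R R

/-- The right socle `S_r`. -/
def rightSocle : Submodule Rᵐᵒᵖ R := moduleSocle Rᵐᵒᵖ R

variable {R}

/-- The principal left ideal `Ra`. -/
def principalLeft (a : R) : Ideal R := Submodule.span R {a}

/-- The principal right ideal `aR`. -/
def principalRight (a : R) : Submodule Rᵐᵒᵖ R := Submodule.span Rᵐᵒᵖ {a}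

/-- A local idempotent: an idempotent `e` such that `End(eR)` is a local ring. -/
def IsLocalIdempotent (e : R) : Prop :=
  IsIdempotentElem e ∧ IsLocalRing (Module.End Rᵐᵒᵖ (principalRight e))

/-- `e₁, …, eₙ` is a basic set of idempotents: it is part of a complete set `ε₁, …, εₘ` of
pairwise orthogonal local idempotents with sum `1`, and each right ideal `εⱼR` is isomorphic to
`eₖR` for exactly one index `k`. -/
def IsBasicSet {n : ℕ} (e : Fin n → R) : Prop :=
  ∃ (m : ℕ) (ε : Fin m → R),
    CompleteOrthogonalIdempotents ε ∧
    (∀ j, IsLocalIdempotent (ε j)) ∧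
    (∃ ι : Fin n ↪ Fin m, ∀ k, e k = ε (ι k)) ∧
    ∀ j, ∃! k, Nonempty (principalRight (ε j) ≃ₗ[Rᵐᵒᵖ] principalRight (e k))

/-- `π` is a Nakayama permutation with respect to `e₁, …, eₙ`: for each `k`,
`soc(eₖR) ≅ top(e_{π(k)}R)` as right modules and `soc(Re_{π(k)}) ≅ top(Reₖ)` as left modules. -/
def IsNakayamaPermutation {n : ℕ} (e : Fin n → R) (π : Equiv.Perm (Fin n)) : Prop :=
  ∀ k,
    Nonempty (moduleSocle Rᵐᵒᵖ (principalRight (e k)) ≃ₗ[Rᵐᵒᵖ]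
      ModuleTop Rᵐᵒᵖ (principalRight (e (π k)))) ∧
    Nonempty (moduleSocle R (principalLeft (e (π k))) ≃ₗ[R]
      ModuleTop R (principalLeft (e k)))

/-- The left annihilator `l(X) = {a | aX = 0}`, a left ideal. -/
def leftAnn (X : Set R) : Ideal R where
  carrier := {a | ∀ x ∈ X, a * x = 0}
  add_mem' := fun ha hb x hx => by rw [add_mul, ha x hx, hb x hx, add_zero]
  zero_mem' := fun x _ => zero_mul x
  smul_mem' := fun c a ha x hx => by rw [smul_eq_mul, mul_assoc, ha x hx, mul_zero]

/-- The right annihilator `r(X) = {a | Xa = 0}`, a right ideal. -/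
def rightAnn (X : Set R) : Submodule Rᵐᵒᵖ R where
  carrier := {a | ∀ x ∈ X, x * a = 0}
  add_mem' := fun ha hb x hx => by rw [mul_add, ha x hx, hb x hx, add_zero]
  zero_mem' := fun x _ => mul_zero x
  smul_mem' := fun c a ha x hx => by
    change x * (a * unop c) = 0
    rw [← mul_assoc, ha x hx, zero_mul]

/-- A left ideal `I` is a left D-ideal if `l(r(I)) = I`. -/
def IsLeftDIdeal (I : Ideal R) : Prop := leftAnn (rightAnn (I : Set R) : Set R) = I

/-- A right ideal `I` is a right D-ideal if `r(l(I)) = I`. -/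
def IsRightDIdeal (I : Submodule Rᵐᵒᵖ R) : Prop := rightAnn (leftAnn (I : Set R) : Set R) = I

variable (R)

/-- Left Kasch: every simple left module is isomorphic to a left ideal. (Every simple module is
cyclic, so the modules in the universe of `R` represent all of them.) -/
def IsLeftKasch : Prop :=
  ∀ (T : Type u) [AddCommGroup T] [Module R T] [IsSimpleModule R T],
    ∃ I : Ideal R, Nonempty (T ≃ₗ[R] I)

/-- Right Kasch: every simple right module is isomorphic to a right ideal. -/
def IsRightKasch : Prop :=
  ∀ (T : Type u) [AddCommGroup T] [Module Rᵐᵒᵖ T] [IsSimpleModule Rᵐᵒᵖ T],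
    ∃ I : Submodule Rᵐᵒᵖ R, Nonempty (T ≃ₗ[Rᵐᵒᵖ] I)

/-- A Kasch ring: left and right Kasch. -/
def IsKaschRing : Prop := IsLeftKasch R ∧ IsRightKasch R

/-- A minannihilator ring: simple left ideals are left D-ideals and simple right ideals are right
D-ideals. -/
def IsMinannihilatorRing : Prop :=
  (∀ I : Ideal R, IsSimpleModule R I → IsLeftDIdeal I) ∧
    ∀ I : Submodule Rᵐᵒᵖ R, IsSimpleModule Rᵐᵒᵖ I → IsRightDIdeal I

/-- The one-sided ideals contained in the socle of the same side, and the one-sided ideals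
containing `J(R)`, are D-ideals. -/
def SocleAndTopDIdeals : Prop :=
  (∀ I : Submodule Rᵐᵒᵖ R, I ≤ rightSocle R → IsRightDIdeal I) ∧
  (∀ I : Ideal R, I ≤ leftSocle R → IsLeftDIdeal I) ∧
  (∀ I : Submodule Rᵐᵒᵖ R, jacobsonRight R ≤ I → IsRightDIdeal I) ∧
  ∀ I : Ideal R, Ring.jacobson R ≤ I → IsLeftDIdeal I

/-- `r` and `l` induce mutually inverse lattice anti-isomorphisms between the left submodules of
`top(R) = R / J(R)` and the right submodules of `S_r`. A submodule `N` of `R / J(R)` is identified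
with its preimage in `R`, and a submodule of `S_r` with its image in `R`. -/
def AnnLeftTopRightSocle : Prop :=
  ∃ φ : Submodule R (R ⧸ Ring.jacobson R) ≃o (Submodule Rᵐᵒᵖ (rightSocle R))ᵒᵈ,
    (∀ N : Submodule R (R ⧸ Ring.jacobson R),
      (OrderDual.ofDual (φ N)).map (rightSocle R).subtype =
        rightAnn (N.comap (Ring.jacobson R).mkQ : Set R)) ∧
    ∀ I : Submodule Rᵐᵒᵖ (rightSocle R),
      (φ.symm (OrderDual.toDual I)).comap (Ring.jacobson R).mkQ =
        leftAnn (I.map (rightSocle R).subtype : Set R)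

/-- `r` and `l` induce mutually inverse lattice anti-isomorphisms between the left submodules of
`S_l` and the right submodules of `top(R) = R / J(R)`. -/
def AnnLeftSocleRightTop : Prop :=
  ∃ φ : Submodule R (leftSocle R) ≃o (Submodule Rᵐᵒᵖ (R ⧸ jacobsonRight R))ᵒᵈ,
    (∀ I : Submodule R (leftSocle R),
      (OrderDual.ofDual (φ I)).comap (jacobsonRight R).mkQ =
        rightAnn (I.map (leftSocle R).subtype : Set R)) ∧
    ∀ N : Submodule Rᵐᵒᵖ (R ⧸ jacobsonRight R),
      (φ.symm (OrderDual.toDual N)).map (leftSocle R).subtype =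
        leftAnn (N.comap (jacobsonRight R).mkQ : Set R)

end Rings

/-!
Every notion in the theorem is left-right symmetric, so most lemmas are stated for left ideals and
for conditions on elements, and their mirror images are obtained by applying them to `Rᵐᵒᵖ`. This
rests on two facts: `J(Rᵐᵒᵖ) = J(R)` (`op_mem_jacobson`), and `R / J(R)` semisimple implies
`Rᵐᵒᵖ / J(Rᵐᵒᵖ)` semisimple (`isSemisimpleRing_op_quotient_jacobson`). Over such a ring the socle of
a module is the set of elements killed by the radical (`mem_moduleSocle_iff`), so that
`S_l = r(J)` and `S_r = l(J)`.

*Basic sets.* The components of `1` in a decomposition of `R / J(R)` into simple left ideals are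
orthogonal idempotents. They lift to orthogonal idempotents of `R`
(`exists_orthogonalIdempotents_lift`), and the lifts are local (`isCornerLocal_of_isLeftMinimal`).
Local idempotents are handled through `IsCornerLocal`: elements of `eRe` outside `J` are invertible
in `eRe`.

*Kasch minannihilator rings and D-ideals.* In a Kasch minannihilator ring `Ra` is simple exactly when
`aR` is (`isLeftMinimal_iff_isRightMinimal`), so `S_l = S_r`. A left ideal containing `J` is an
intersection of maximal left ideals, each of which is an annihilator `l(b)` by the Kasch condition,
so it is a D-ideal. A left ideal in the socle is a D-ideal because adding one simple left ideal
preserves this property (`IsLeftDIdeal.sup_principalLeft`) and the descending chain condition in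
`R / J(R)` reduces to finitely many steps (`isLeftDIdeal_of_le_leftSocle`). The lattice
anti-isomorphisms are a reformulation of the D-ideal conditions together with `S_l = S_r`
(`socleAndTopDIdeals_iff_annihilator`).

*Nakayama permutations.* In a Kasch minannihilator ring the socle of `eₖR` is the annihilator of the
maximal left ideal `{x | x eₖ ∈ J}`, hence a simple right ideal
(`IsCornerLocal.exists_socle_generator`). A generator `b` chosen in `eₖReⱼ` generates the socle of
`Reⱼ` as well, and `π(k) = j` is a Nakayama permutation. Conversely, a Nakayama permutation makes the
socles of all `Reₖ` and `eₖR` simple and embeds every simple module into the ring. With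
`S_l = S_r` this gives the minannihilator condition
(`isRightMinannihilator_of_hasSimpleSocle`).
-/

/-! ### The Jacobson radical and the opposite ring -/

section Jacobson

variable {R : Type u} [Ring R]

theorem isUnit_one_add_of_mem_jacobson {x : R} (hx : x ∈ Ring.jacobson R) : IsUnit (1 + x) := by
  have key : ∀ y ∈ Ring.jacobson R, ∃ z, z * (1 + y) = 1 := fun y hy ↦ by
    rw [← Ideal.jacobson_bot, Ideal.mem_jacobson_iff] at hy
    obtain ⟨z, hz⟩ := hy 1
    refine ⟨z, ?_⟩
    exact (by noncomm_ring : z * (1 + y) = z * 1 * y + z).trans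
      (sub_eq_zero.mp (Ideal.mem_bot.mp hz))
  obtain ⟨z, hz⟩ := key x hx
  -- The left inverse `z = 1 - zx` is again of the form `1 + y`, so it has a left inverse itself.
  obtain ⟨w, hw⟩ := key (-(z * x)) ((Ring.jacobson R).neg_mem ((Ring.jacobson R).mul_mem_left _ hx))
  have hz' : 1 + -(z * x) = z := by
    rw [mul_add, mul_one] at hz
    rw [← hz]
    abel
  rw [hz'] at hw
  have : w = 1 + x := by
    calc w = w * (z * (1 + x)) := by rw [hz, mul_one]
      _ = 1 + x := by rw [← mul_assoc, hw, one_mul]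
  exact ⟨⟨1 + x, z, this ▸ hw, hz⟩, rfl⟩

theorem mem_jacobson_of_forall_exists {x : R} (h : ∀ y, ∃ z, z * (1 + y * x) = 1) :
    x ∈ Ring.jacobson R := by
  rw [← Ideal.jacobson_bot, Ideal.mem_jacobson_iff]
  intro y
  obtain ⟨z, hz⟩ := h y
  refine ⟨z, ?_⟩
  rw [Ideal.mem_bot, sub_eq_zero, ← hz]
  noncomm_ring

/-- If `z` is a left inverse of `1 + b * a`, then `1 - a * z * b` is a left inverse of
`1 + a * b`. -/
theorem exists_mul_one_add_comm {a b : R} (h : ∃ z, z * (1 + b * a) = 1) :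
    ∃ z, z * (1 + a * b) = 1 := by
  obtain ⟨z, hz⟩ := h
  refine ⟨1 - a * z * b, ?_⟩
  have : a * (z * (1 + b * a)) * b = a * b := by rw [hz, mul_one]
  calc (1 - a * z * b) * (1 + a * b) = 1 + (a * b - a * (z * (1 + b * a)) * b) := by
        noncomm_ring
    _ = 1 := by rw [this, sub_self, add_zero]

theorem jacobson_mul_mem_left {x : R} (r : R) (hx : x ∈ Ring.jacobson R) :
    r * x ∈ Ring.jacobson R :=
  (Ring.jacobson R).mul_mem_left r hx

theorem jacobson_mul_mem_right {x : R} (r : R) (hx : x ∈ Ring.jacobson R) :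
    x * r ∈ Ring.jacobson R :=
  (Ring.jacobson R).mul_mem_right r hx

/-- The Jacobson radical, defined through left ideals, is left-right symmetric. -/
theorem op_mem_jacobson {x : R} : op x ∈ Ring.jacobson Rᵐᵒᵖ ↔ x ∈ Ring.jacobson R := by
  constructor
  · intro hx
    refine mem_jacobson_of_forall_exists fun y ↦ ?_
    obtain ⟨v, hv⟩ := (isUnit_one_add_of_mem_jacobson (jacobson_mul_mem_right (op y) hx)).unop
    refine ⟨↑v⁻¹, ?_⟩
    have : 1 + y * x = v := by rw [hv]; rfl
    rw [this, v.inv_mul]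
  · intro hx
    refine mem_jacobson_of_forall_exists fun y ↦ ?_
    obtain ⟨v, hv⟩ := (isUnit_one_add_of_mem_jacobson (jacobson_mul_mem_right (unop y) hx)).op
    refine ⟨↑v⁻¹, ?_⟩
    have : 1 + y * op x = v := by rw [hv]; rfl
    rw [this, v.inv_mul]

theorem eq_zero_of_isIdempotentElem_of_mem_jacobson {e : R} (he : IsIdempotentElem e)
    (h : e ∈ Ring.jacobson R) : e = 0 := by
  have hu := isUnit_one_add_of_mem_jacobson ((Ring.jacobson R).neg_mem h)
  refine hu.mul_right_eq_zero.mp ?_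
  rw [add_mul, neg_mul, he.eq, one_mul, add_neg_cancel]

/-- Being semilocal is left-right symmetric: `Rᵐᵒᵖ / J(Rᵐᵒᵖ)` is the opposite ring of `R / J(R)`,
and semisimplicity passes to the opposite ring by the Wedderburn–Artin theorem. -/
theorem isSemisimpleRing_op_quotient_jacobson (h : IsSemisimpleRing (R ⧸ Ring.jacobson R)) :
    IsSemisimpleRing (Rᵐᵒᵖ ⧸ Ring.jacobson Rᵐᵒᵖ) := by
  let f : Rᵐᵒᵖ →+* (R ⧸ Ring.jacobson R)ᵐᵒᵖ := (Ideal.Quotient.mk (Ring.jacobson R)).op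
  have hf : Function.Surjective f := fun y ↦ by
    obtain ⟨x, hx⟩ := Ideal.Quotient.mk_surjective (unop y)
    exact ⟨op x, unop_injective hx⟩
  have hker : RingHom.ker f = Ring.jacobson Rᵐᵒᵖ := by
    ext x
    obtain ⟨x, rfl⟩ := op_surjective x
    rw [op_mem_jacobson, RingHom.mem_ker]
    change op (Ideal.Quotient.mk _ x) = 0 ↔ _
    rw [op_eq_zero_iff, Ideal.Quotient.eq_zero_iff_mem]
  have e := RingHom.quotientKerEquivOfSurjective hf
  have e' : Rᵐᵒᵖ ⧸ RingHom.ker f ≃+* Rᵐᵒᵖ ⧸ Ring.jacobson Rᵐᵒᵖ := Ideal.quotEquivOfEq hker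
  exact (e.symm.trans e').isSemisimpleRing

end Jacobson

/-! ### Generators of simple one-sided ideals -/

section Minimal

variable {R : Type u} [Ring R]

/-- The left ideal `Ra` is simple, in elementwise form. -/
def IsLeftMinimal (a : R) : Prop := a ≠ 0 ∧ ∀ s, s * a ≠ 0 → ∃ t, t * (s * a) = a

/-- The right ideal `aR` is simple, in elementwise form. -/
def IsRightMinimal (a : R) : Prop := a ≠ 0 ∧ ∀ s, a * s ≠ 0 → ∃ t, a * s * t = a

variable (R) in
/-- Every simple left ideal `Ra` satisfies `lr(Ra) = Ra`; the condition on `z` says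
`r(a) ⊆ r(z)`, that is `z ∈ lr(Ra)`. -/
def IsLeftMinannihilator : Prop :=
  ∀ a : R, IsLeftMinimal a → ∀ z, (∀ x, a * x = 0 → z * x = 0) → ∃ t, z = t * a

variable (R) in
/-- Every simple right ideal `aR` satisfies `rl(aR) = aR`; the condition on `z` says
`l(a) ⊆ l(z)`, that is `z ∈ rl(aR)`. -/
def IsRightMinannihilator : Prop :=
  ∀ a : R, IsRightMinimal a → ∀ z, (∀ x, x * a = 0 → x * z = 0) → ∃ t, z = a * t

theorem isLeftMinimal_op {a : R} : IsLeftMinimal (op a) ↔ IsRightMinimal a := by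
  simp only [IsLeftMinimal, IsRightMinimal, MulOpposite.forall, MulOpposite.exists, ← op_mul,
    ne_eq, op_eq_zero_iff, op_inj]

theorem isRightMinimal_op {a : R} : IsRightMinimal (op a) ↔ IsLeftMinimal a := by
  simp only [IsLeftMinimal, IsRightMinimal, MulOpposite.forall, MulOpposite.exists, ← op_mul,
    ne_eq, op_eq_zero_iff, op_inj]

theorem isLeftMinannihilator_op : IsLeftMinannihilator Rᵐᵒᵖ ↔ IsRightMinannihilator R := by
  simp only [IsLeftMinannihilator, IsRightMinannihilator, MulOpposite.forall, MulOpposite.exists,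
    ← op_mul, op_eq_zero_iff, op_inj, isLeftMinimal_op]

theorem isRightMinannihilator_op : IsRightMinannihilator Rᵐᵒᵖ ↔ IsLeftMinannihilator R := by
  simp only [IsLeftMinannihilator, IsRightMinannihilator, MulOpposite.forall, MulOpposite.exists,
    ← op_mul, op_eq_zero_iff, op_inj, isRightMinimal_op]

/-- If `a` is itself a right multiple of `au`, then `l(a) = l(au)`, so `Ra ≅ Rau`. -/
theorem IsLeftMinimal.of_mul_right {a u v : R} (h : IsLeftMinimal (a * u)) (hv : a * u * v = a) :
    IsLeftMinimal a := by
  have key : ∀ s, s * a ≠ 0 → s * (a * u) ≠ 0 := fun s hs h0 ↦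
    hs (by rw [← hv, ← mul_assoc, h0, zero_mul])
  refine ⟨fun h0 ↦ h.1 (by rw [h0, zero_mul]), fun s hs ↦ ?_⟩
  obtain ⟨t, ht⟩ := h.2 s (key s hs)
  refine ⟨t, ?_⟩
  calc t * (s * a) = t * (s * (a * u)) * v := by simp only [mul_assoc] at hv ⊢; rw [hv]
    _ = a := by rw [ht, hv]

/-- A nonzero right multiple `as` generates the simple right ideal `aR`. -/
theorem IsRightMinimal.mul_right {a s : R} (h : IsRightMinimal a) (hs : a * s ≠ 0) :
    IsRightMinimal (a * s) := by
  obtain ⟨t, ht⟩ := h.2 s hs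
  refine ⟨hs, fun s' hs' ↦ ?_⟩
  obtain ⟨t', ht'⟩ := h.2 (s * s') (by rwa [← mul_assoc])
  exact ⟨t' * s, by simp only [← mul_assoc] at ht' ⊢; rw [ht']⟩

/-- A nonzero right multiple `au` of an element with `Ra` simple again generates a simple left
ideal, since `Ra → Rau` is an isomorphism. -/
theorem IsLeftMinimal.mul_right {a u : R} (h : IsLeftMinimal a) (hu : a * u ≠ 0) :
    IsLeftMinimal (a * u) := by
  refine ⟨hu, fun s hs ↦ ?_⟩
  obtain ⟨t, ht⟩ := h.2 s (fun h0 ↦ hs (by rw [← mul_assoc, h0, zero_mul]))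
  exact ⟨t, by simp only [← mul_assoc] at ht ⊢; rw [ht]⟩

end Minimal

/-! ### Maximal left ideals and the Kasch condition -/

section Kasch

variable {R : Type u} [Ring R]

variable (R) in
/-- The left Kasch condition in elementwise form: every maximal left ideal annihilates some
nonzero element from the left. -/
def HasMaximalLeftAnnihilators : Prop :=
  ∀ L : Ideal R, L.IsMaximal → ∃ b : R, b ≠ 0 ∧ ∀ x ∈ L, x * b = 0

/-- A maximal left ideal with `Lb = 0`, `b ≠ 0`, equals the annihilator of `b`. -/
theorem Ideal.IsMaximal.mem_of_mul_eq_zero {L : Ideal R} (hL : L.IsMaximal) {b : R} (hb : b ≠ 0)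
    (h : ∀ x ∈ L, x * b = 0) {y : R} (hy : y * b = 0) : y ∈ L := by
  by_contra hyL
  obtain ⟨r, i, hi, h1⟩ := hL.exists_inv hyL
  apply hb
  rw [← one_mul b, ← h1, add_mul, mul_assoc, hy, h i hi, mul_zero, add_zero]

/-- If the left annihilator of `a` is a maximal left ideal then `Ra` is simple. -/
theorem isLeftMinimal_of_isMaximal {L : Ideal R} (hL : L.IsMaximal) {a : R} (ha : a ≠ 0)
    (h : ∀ x ∈ L, x * a = 0) : IsLeftMinimal a := by
  refine ⟨ha, fun s hs ↦ ?_⟩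
  obtain ⟨r, i, hi, h1⟩ := hL.exists_inv (fun hsL ↦ hs (h s hsL))
  refine ⟨r, ?_⟩
  calc r * (s * a) = (r * s + i) * a := by rw [add_mul, h i hi, add_zero, mul_assoc]
    _ = a := by rw [h1, one_mul]

/-- In a left Kasch, right minannihilator ring, `Ra` is simple whenever `aR` is simple: a maximal
left ideal `l(b)` containing `l(a)` satisfies `b ∈ rl(aR) = aR`, hence `bR = aR` and
`l(a) = l(b)`. -/
theorem IsRightMinimal.isLeftMinimal (hK : HasMaximalLeftAnnihilators R)
    (hM : IsRightMinannihilator R) {a : R} (ha : IsRightMinimal a) : IsLeftMinimal a := by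
  have hne : leftAnn ({a} : Set R) ≠ ⊤ := fun h ↦ ha.1 <| by
    have : (1 : R) ∈ leftAnn ({a} : Set R) := h ▸ Submodule.mem_top
    rw [← one_mul a]; exact this a rfl
  obtain ⟨L, hL, hle⟩ := Ideal.exists_le_maximal _ hne
  obtain ⟨b, hb, hLb⟩ := hK L hL
  obtain ⟨t, rfl⟩ := hM a ha b fun x hx ↦ hLb x (hle (by rintro _ rfl; exact hx))
  obtain ⟨s, hs⟩ := ha.2 t hb
  refine isLeftMinimal_of_isMaximal hL ha.1 fun x hx ↦ ?_
  rw [← hs, ← mul_assoc, hLb x hx, zero_mul]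

end Kasch

/-! ### Local idempotents and their corner rings -/

section Corner

variable {R : Type u} [Ring R]

/-- `y` is an element of the corner ring `eRe` that is invertible there. -/
def IsCornerUnit (e y : R) : Prop := ∃ v, e * v * e = v ∧ v * y = e ∧ y * v = e

/-- A left-right symmetric form of "`e` is a local idempotent": every element of `eRe` outside
`J(R)` is invertible in `eRe`. -/
structure IsCornerLocal (e : R) : Prop where
  idem : IsIdempotentElem e
  notMem : e ∉ Ring.jacobson R
  isCornerUnit : ∀ x, e * x * e = x → x ∉ Ring.jacobson R → IsCornerUnit e x

theorem IsCornerLocal.op {e : R} (h : IsCornerLocal e) : IsCornerLocal (op e) where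
  idem := congrArg MulOpposite.op h.idem
  notMem := op_mem_jacobson.not.mpr h.notMem
  isCornerUnit x hx hxJ := by
    obtain ⟨x, rfl⟩ := op_surjective x
    rw [← op_mul, ← op_mul, op_inj, ← mul_assoc] at hx
    obtain ⟨v, hv, h1, h2⟩ := h.isCornerUnit x hx (op_mem_jacobson.not.mp hxJ)
    refine ⟨MulOpposite.op v, ?_, ?_, ?_⟩
    · rw [← op_mul, ← op_mul, ← mul_assoc, hv]
    · rw [← op_mul, h2]
    · rw [← op_mul, h1]

theorem IsIdempotentElem.mul_mul_eq_left {e x : R} (he : IsIdempotentElem e) (hx : e * x * e = x) :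
    e * x = x := by
  rw [← hx, ← mul_assoc, ← mul_assoc, he.eq]

theorem IsIdempotentElem.mul_mul_eq_right {e x : R} (he : IsIdempotentElem e)
    (hx : e * x * e = x) : x * e = x := by
  rw [← hx, mul_assoc, he.eq]

/-- An element of `Re` lies in `J(R)` as soon as all its multiples in the corner `eRe` do. -/
theorem mem_jacobson_of_corner {e m : R} (hm : m * e = m)
    (h : ∀ s, e * s * m ∈ Ring.jacobson R) : m ∈ Ring.jacobson R := by
  refine mem_jacobson_of_forall_exists fun y ↦ ?_
  have key : ∃ z, z * (1 + e * (y * m)) = 1 := by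
    rw [← mul_assoc]
    obtain ⟨v, hv⟩ := isUnit_one_add_of_mem_jacobson (h y)
    exact ⟨↑v⁻¹, by rw [← hv, v.inv_mul]⟩
  have := exists_mul_one_add_comm key
  rwa [mul_assoc, hm] at this

/-- `Je` is the only maximal submodule of `Re`: any other element of `Re` generates it. -/
theorem IsCornerLocal.exists_mul_eq {e m : R} (h : IsCornerLocal e) (hm : m * e = m)
    (hmJ : m ∉ Ring.jacobson R) : ∃ t, t * m = e := by
  by_contra! hcon
  refine hmJ (mem_jacobson_of_corner hm fun s ↦ ?_)
  by_contra hs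
  obtain ⟨v, -, hv, -⟩ := h.isCornerUnit (e * s * m)
    (by rw [mul_assoc _ _ e, mul_assoc, mul_assoc, hm, ← mul_assoc, h.idem.eq, mul_assoc]) hs
  exact hcon (v * (e * s)) (by rw [mul_assoc, hv])

theorem IsCornerLocal.exists_mul_eq' {e m : R} (h : IsCornerLocal e) (hm : e * m = m)
    (hmJ : m ∉ Ring.jacobson R) : ∃ t, m * t = e := by
  obtain ⟨t, ht⟩ := h.op.exists_mul_eq (m := MulOpposite.op m) (by rw [← op_mul, hm])
    (op_mem_jacobson.not.mpr hmJ)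
  exact ⟨unop t, op_injective (by rw [op_mul, op_unop, ht])⟩

/-- The idempotents `e` and `f` are isomorphic: `eR ≅ fR`, equivalently `Re ≅ Rf`. -/
def IdempotentIso (e f : R) : Prop := ∃ a b, e * a * f = a ∧ f * b * e = b ∧ a * b = e ∧ b * a = f

/-- For local idempotents, an element of `eRf` outside the radical is an isomorphism. -/
theorem IsCornerLocal.idempotentIso {e f x : R} (he : IsCornerLocal e) (hf : IsCornerLocal f)
    (hx : e * x * f = x) (hxJ : x ∉ Ring.jacobson R) : IdempotentIso e f := by
  have hex : e * x = x := by rw [← hx, ← mul_assoc, ← mul_assoc, he.idem.eq]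
  have hxf : x * f = x := by rw [← hx, mul_assoc, hf.idem.eq]
  obtain ⟨t, ht⟩ := hf.exists_mul_eq hxf hxJ
  obtain ⟨t', ht'⟩ := he.exists_mul_eq' hex hxJ
  have hy : f * t * e = f * t' := by
    calc f * t * e = f * (t * x) * t' := by rw [← ht']; simp only [mul_assoc]
      _ = f * t' := by rw [ht, hf.idem.eq]
  refine ⟨x, f * t * e, hx, ?_, ?_, ?_⟩
  · simp only [← mul_assoc, hf.idem.eq]; simp only [mul_assoc, he.idem.eq]
  · rw [hy, ← mul_assoc, hxf, ht']
  · rw [mul_assoc, hex, mul_assoc, ht, hf.idem.eq]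

end Corner

/-! ### Endomorphisms of principal right ideals -/

section PrincipalRight

variable {R : Type u} [Ring R]

theorem mem_principalRight {a x : R} : x ∈ principalRight a ↔ ∃ t, a * t = x := by
  rw [principalRight, Submodule.mem_span_singleton]
  exact ⟨fun ⟨t, h⟩ ↦ ⟨unop t, h⟩, fun ⟨t, h⟩ ↦ ⟨op t, h⟩⟩

theorem mem_principalLeft {a x : R} : x ∈ principalLeft a ↔ ∃ t, t * a = x := by
  rw [principalLeft, Submodule.mem_span_singleton]
  rfl

theorem IsIdempotentElem.mem_principalRight {e x : R} (he : IsIdempotentElem e) :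
    x ∈ principalRight e ↔ e * x = x := by
  rw [_root_.mem_principalRight]
  exact ⟨fun ⟨t, h⟩ ↦ by rw [← h, ← mul_assoc, he.eq], fun h ↦ ⟨x, h⟩⟩

theorem IsIdempotentElem.mem_principalLeft {e x : R} (he : IsIdempotentElem e) :
    x ∈ principalLeft e ↔ x * e = x := by
  rw [_root_.mem_principalLeft]
  exact ⟨fun ⟨t, h⟩ ↦ by rw [← h, mul_assoc, he.eq], fun h ↦ ⟨x, h⟩⟩

/-- The generator of `aR`. -/
def principalRightGen (a : R) : principalRight a := ⟨a, Submodule.mem_span_singleton_self a⟩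

/-- A homomorphism out of `eR` is multiplication of the image of `e`. -/
theorem map_principalRight {e f : R} (he : IsIdempotentElem e)
    (φ : principalRight e →ₗ[Rᵐᵒᵖ] principalRight f) (x : principalRight e) :
    (φ x : R) = φ (principalRightGen e) * x := by
  have : x = op (x : R) • principalRightGen e :=
    Subtype.ext (he.mem_principalRight.mp x.2).symm
  conv_lhs => rw [this, map_smul]
  rfl

/-- Left multiplication by `a`, as a homomorphism `eR → fR`, for `a ∈ fR`. -/
def mulLeftPrincipalRight (e : R) {f a : R} (ha : a ∈ principalRight f) :
    principalRight e →ₗ[Rᵐᵒᵖ] principalRight f where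
  toFun x := ⟨a * x, (principalRight f).smul_mem (op (x : R)) ha⟩
  map_add' x y := Subtype.ext (mul_add a x y)
  map_smul' c x := Subtype.ext (mul_assoc a x (unop c)).symm

theorem nonempty_principalRight_equiv_iff {e f : R} (he : IsIdempotentElem e)
    (hf : IsIdempotentElem f) :
    Nonempty (principalRight e ≃ₗ[Rᵐᵒᵖ] principalRight f) ↔ IdempotentIso e f := by
  constructor
  · rintro ⟨φ⟩
    set a : R := (φ.symm (principalRightGen f)).1
    set b : R := (φ (principalRightGen e)).1
    have hea : e * a = a := he.mem_principalRight.mp (φ.symm (principalRightGen f)).2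
    have hfb : f * b = b := hf.mem_principalRight.mp (φ (principalRightGen e)).2
    have haf : a * f = a := (map_principalRight hf φ.symm.toLinearMap (principalRightGen f)).symm
    have hbe : b * e = b := (map_principalRight he φ.toLinearMap (principalRightGen e)).symm
    refine ⟨a, b, by rw [hea, haf], by rw [hfb, hbe], ?_, ?_⟩
    · refine (map_principalRight hf φ.symm.toLinearMap (φ (principalRightGen e))).symm.trans ?_
      simp [principalRightGen]
    · refine (map_principalRight he φ.toLinearMap (φ.symm (principalRightGen f))).symm.trans ?_
      simp [principalRightGen]
  · rintro ⟨a, b, ha, hb, hab, hba⟩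
    have hae : a ∈ principalRight e := mem_principalRight.mpr ⟨a * f, by rw [← mul_assoc, ha]⟩
    have hbf : b ∈ principalRight f := mem_principalRight.mpr ⟨b * e, by rw [← mul_assoc, hb]⟩
    refine ⟨LinearEquiv.ofLinearMap (mulLeftPrincipalRight e hbf) (mulLeftPrincipalRight f hae)
      (LinearMap.ext fun x ↦ Subtype.ext ?_) (LinearMap.ext fun x ↦ Subtype.ext ?_)⟩
    · change b * (a * (x : R)) = x
      rw [← mul_assoc, hba, hf.mem_principalRight.mp x.2]
    · change a * (b * (x : R)) = x
      rw [← mul_assoc, hab, he.mem_principalRight.mp x.2]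

/-- The units of `End(eR)` are the left multiplications by units of `eRe`. -/
theorem isUnit_end_principalRight_iff {e : R} (he : IsIdempotentElem e)
    (φ : Module.End Rᵐᵒᵖ (principalRight e)) :
    IsUnit φ ↔ IsCornerUnit e (φ (principalRightGen e) : R) := by
  constructor
  · rintro ⟨u, rfl⟩
    set v : R := ((u⁻¹ : (Module.End Rᵐᵒᵖ (principalRight e))ˣ).1 (principalRightGen e)).1
    have hev : e * v = v := he.mem_principalRight.mp (Subtype.prop _)
    have hve : v * e = v := (map_principalRight he _ (principalRightGen e)).symm
    refine ⟨v, by rw [hev, hve], ?_, ?_⟩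
    · rw [← map_principalRight he, ← Module.End.mul_apply, u.inv_mul]; rfl
    · rw [← map_principalRight he, ← Module.End.mul_apply, u.mul_inv]; rfl
  · rintro ⟨v, hv, h1, h2⟩
    have hve : v ∈ principalRight e := mem_principalRight.mpr ⟨v * e, by rw [← mul_assoc, hv]⟩
    refine ⟨⟨φ, mulLeftPrincipalRight e hve, LinearMap.ext fun x ↦ Subtype.ext ?_,
      LinearMap.ext fun x ↦ Subtype.ext ?_⟩, rfl⟩
    · rw [Module.End.mul_apply, map_principalRight he]
      change _ * (v * (x : R)) = x
      rw [← mul_assoc, h2, he.mem_principalRight.mp x.2]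
    · rw [Module.End.mul_apply]
      change v * (φ x : R) = x
      rw [map_principalRight he, ← mul_assoc, h1, he.mem_principalRight.mp x.2]

/-- An idempotent with local endomorphism ring is local in the elementwise sense: if no multiple
`erx` of `x ∈ eRe` is invertible in `eRe`, then all `e - erx` are, and so `x ∈ J(R)`. -/
theorem IsLocalIdempotent.isCornerLocal {e : R} (h : IsLocalIdempotent e) : IsCornerLocal e := by
  obtain ⟨he, hloc⟩ := h
  have dich : ∀ y, e * y * e = y → IsCornerUnit e y ∨ IsCornerUnit e (e - y) := by
    intro y hy
    have hye : y ∈ principalRight e := he.mem_principalRight.mpr (he.mul_mul_eq_left hy)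
    let φ := mulLeftPrincipalRight e hye
    have hφ : (φ (principalRightGen e) : R) = y := he.mul_mul_eq_right hy
    refine (IsLocalRing.isUnit_or_isUnit_of_add_one (add_sub_cancel φ 1)).imp (fun hu ↦ ?_)
      fun hu ↦ ?_
    · rwa [isUnit_end_principalRight_iff he, hφ] at hu
    · rw [isUnit_end_principalRight_iff he, LinearMap.sub_apply, Submodule.coe_sub, hφ] at hu
      exact hu
  refine ⟨he, fun heJ ↦ ?_, fun x hx hxJ ↦ ?_⟩
  · have h0 := eq_zero_of_isIdempotentElem_of_mem_jacobson he heJ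
    obtain ⟨x, y, hxy⟩ := exists_pair_ne (Module.End Rᵐᵒᵖ (principalRight e))
    refine hxy (LinearMap.ext fun z ↦ Subtype.ext ?_)
    rw [map_principalRight he, map_principalRight he]
    have : (z : R) = 0 := (he.mem_principalRight.mp z.2).symm.trans (mul_eq_zero_of_left h0 _)
    rw [map_principalRight he, map_principalRight he y]
    simp only [this, mul_zero]
  · have hex := he.mul_mul_eq_left hx
    have hxe := he.mul_mul_eq_right hx
    by_cases hex' : ∃ r, IsCornerUnit e (e * r * x)
    · obtain ⟨r, v, hv, h1, -⟩ := hex'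
      set s := v * e * r * e with hs
      have hse : e * s * e = s := by
        have := he.mul_mul_eq_left hv
        simp only [hs, mul_assoc, he.eq]
        simp only [← mul_assoc, this]
      have hsx : s * x = e := by
        rw [hs, mul_assoc _ e x, hex]; simpa only [mul_assoc] using h1
      have hp : (x * s) * (x * s) = x * s := by
        rw [mul_assoc, ← mul_assoc s, hsx, he.mul_mul_eq_left hse]
      have hpe' : (x * s) * e = x * s := by rw [mul_assoc, he.mul_mul_eq_right hse]
      have hpe : e * (x * s) * e = x * s := by rw [← mul_assoc, hex, hpe']
      rcases dich _ hpe with ⟨w, -, -, hw⟩ | ⟨w, -, -, hw⟩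
      · refine ⟨s, hse, hsx, ?_⟩
        rw [← hpe']
        nth_rewrite 1 [← hw]
        rw [← mul_assoc, hp, hw]
      · exfalso
        have h0 : x * s = 0 := by
          calc x * s = (x * s) * ((e - x * s) * w) := by rw [hw, hpe']
            _ = 0 := by rw [← mul_assoc, mul_sub, hpe', hp, sub_self, zero_mul]
        apply hxJ
        rw [← hxe, ← hsx, ← mul_assoc, h0, zero_mul]
        exact zero_mem _
    · push Not at hex'
      refine absurd (mem_jacobson_of_forall_exists fun y ↦ ?_) hxJ
      have hy : e * (e * -y * x) * e = e * -y * x := by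
        rw [mul_assoc, mul_assoc _ x e, hxe, ← mul_assoc, ← mul_assoc, he.eq]
      obtain ⟨v, hv, hv1, -⟩ := (dich _ hy).resolve_left (hex' _)
      have key : ∃ z, z * (1 + e * (y * x)) = 1 := by
        refine ⟨1 - e + v, ?_⟩
        have h1 : v * (1 + e * (y * x)) = e := by
          calc v * (1 + e * (y * x)) = v * e * (1 + e * (y * x)) := by
                rw [he.mul_mul_eq_right hv]
            _ = v * (e - e * e * -y * x) := by noncomm_ring
            _ = e := by rw [he.eq, hv1]
        rw [add_mul, h1, mul_add, ← mul_assoc, he.one_sub_mul_self]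
        noncomm_ring
      have := exists_mul_one_add_comm key
      rwa [mul_assoc, hxe] at this

end PrincipalRight

/-! ### Lifting idempotents and the existence of basic sets -/

section Existence

variable {R : Type u} [Ring R]

theorem IsCornerLocal.isLocalIdempotent {e : R} (h : IsCornerLocal e) : IsLocalIdempotent e := by
  refine ⟨h.idem, ?_⟩
  have hnt : Nontrivial (Module.End Rᵐᵒᵖ (principalRight e)) := by
    refine ⟨0, 1, fun h01 ↦ h.notMem ?_⟩
    have h0 := congrArg Subtype.val (LinearMap.congr_fun h01 (principalRightGen e))
    have h0' : (0 : R) = e := h0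
    exact h0' ▸ zero_mem _
  refine @IsLocalRing.of_is_unit_or_is_unit_of_add_one _ _ hnt fun {φ ψ} hφψ ↦ ?_
  rw [isUnit_end_principalRight_iff h.idem, isUnit_end_principalRight_iff h.idem]
  have corner : ∀ χ : Module.End Rᵐᵒᵖ (principalRight e),
      e * (χ (principalRightGen e) : R) * e = χ (principalRightGen e) := fun χ ↦ by
    rw [h.idem.mem_principalRight.mp (χ (principalRightGen e)).2]
    exact (map_principalRight h.idem χ (principalRightGen e)).symm
  have hsum : (φ (principalRightGen e) : R) + ψ (principalRightGen e) = e :=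
    congrArg Subtype.val (LinearMap.congr_fun hφψ (principalRightGen e))
  by_contra! hcon
  refine h.notMem (hsum ▸ add_mem ?_ ?_)
  · exact by_contra fun hJ ↦ hcon.1 (h.isCornerUnit _ (corner φ) hJ)
  · exact by_contra fun hJ ↦ hcon.2 (h.isCornerUnit _ (corner ψ) hJ)

/-- If `ē` generates a simple left ideal of `R / J(R)` then `e` is a local idempotent: an element
of `eRe` outside `J(R)` has a left inverse modulo `J(R)`, hence a left inverse in `eRe`, which
again lies outside `J(R)`. -/
theorem isCornerLocal_of_isLeftMinimal {e : R} (he : IsIdempotentElem e)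
    (h : IsLeftMinimal (Ideal.Quotient.mk (Ring.jacobson R) e)) : IsCornerLocal e := by
  have left : ∀ x, e * x * e = x → x ∉ Ring.jacobson R →
      ∃ y, e * y * e = y ∧ y * x = e ∧ y ∉ Ring.jacobson R := by
    intro x hx hxJ
    have hex := he.mul_mul_eq_left hx
    have hxe := he.mul_mul_eq_right hx
    obtain ⟨t, ht⟩ := h.2 (Ideal.Quotient.mk _ x) (by
      rw [← map_mul, hxe, ne_eq, Ideal.Quotient.eq_zero_iff_mem]; exact hxJ)
    obtain ⟨t, rfl⟩ := Ideal.Quotient.mk_surjective t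
    rw [← map_mul, hxe, ← map_mul, Ideal.Quotient.mk_eq_mk_iff_sub_mem] at ht
    obtain ⟨v, hv⟩ := isUnit_one_add_of_mem_jacobson ht
    have htx : ↑v⁻¹ * (t * x) = e := by
      have hve : (v : R) * e = t * x := by
        rw [hv, add_mul, sub_mul, mul_assoc, hxe, he.eq, one_mul, add_sub_cancel]
      rw [← hve, v.inv_mul_cancel_left]
    have hyx : e * (↑v⁻¹ * t) * e * x = e := by
      rw [mul_assoc, hex, mul_assoc, mul_assoc, htx, he.eq]
    refine ⟨e * (↑v⁻¹ * t) * e, ?_, hyx, fun hJ ↦ h.1 ?_⟩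
    · rw [← mul_assoc, ← mul_assoc, he.eq, mul_assoc, he.eq]
    · rw [Ideal.Quotient.eq_zero_iff_mem, ← hyx]
      exact jacobson_mul_mem_right x hJ
  refine ⟨he, fun heJ ↦ h.1 (Ideal.Quotient.eq_zero_iff_mem.mpr heJ), fun x hx hxJ ↦ ?_⟩
  obtain ⟨y, hy, hyx, hyJ⟩ := left x hx hxJ
  obtain ⟨z, hz, hzy, -⟩ := left y hy hyJ
  have : z = x := by
    rw [← he.mul_mul_eq_right hz, ← hyx, ← mul_assoc, hzy, he.mul_mul_eq_left hx]
  exact ⟨y, hy, hyx, this ▸ hzy⟩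

/-- If idempotents lift modulo `J(R)`, which need not be a nil ideal, then an idempotent orthogonal
to `q̄` lifts to an idempotent orthogonal to `q`. -/
theorem exists_orthogonal_lift
    (hlift : ∀ x : R ⧸ Ring.jacobson R, IsIdempotentElem x →
      ∃ e : R, IsIdempotentElem e ∧ Ideal.Quotient.mk (Ring.jacobson R) e = x)
    {q : R} (hq : IsIdempotentElem q) {x : R ⧸ Ring.jacobson R} (hx : IsIdempotentElem x)
    (hqx : Ideal.Quotient.mk _ q * x = 0) (hxq : x * Ideal.Quotient.mk _ q = 0) :
    ∃ e : R, IsIdempotentElem e ∧ Ideal.Quotient.mk (Ring.jacobson R) e = x ∧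
      e * q = 0 ∧ q * e = 0 := by
  obtain ⟨f, hf, rfl⟩ := hlift x hx
  -- `u = 1 - qf` is a unit with `u * f = (1 - q) * f`; conjugate `f` into `(1 - q)R` by `u`.
  have hqf : -(q * f) ∈ Ring.jacobson R := by
    rw [neg_mem_iff, ← Ideal.Quotient.eq_zero_iff_mem, map_mul, hqx]
  obtain ⟨u, hu⟩ := isUnit_one_add_of_mem_jacobson hqf
  have huf : (u : R) * f = (1 - q) * f := by
    rw [hu, add_mul, neg_mul, mul_assoc, hf.eq, sub_mul, sub_eq_add_neg]
  have hπu : Ideal.Quotient.mk (Ring.jacobson R) (u : R) = 1 := by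
    rw [hu, map_add, Ideal.Quotient.eq_zero_iff_mem.mpr hqf, map_one, add_zero]
  have hπu' : Ideal.Quotient.mk (Ring.jacobson R) (↑u⁻¹ : R) = 1 := by
    have := congrArg (Ideal.Quotient.mk (Ring.jacobson R)) u.mul_inv
    rwa [map_mul, hπu, one_mul, map_one] at this
  set g : R := u * f * ↑u⁻¹ with hg
  have hqg : q * g = 0 := by
    rw [hg, huf, ← mul_assoc, ← mul_assoc, hq.mul_one_sub_self, zero_mul, zero_mul]
  have hgg : g * g = g := by
    calc g * g = u * f * (↑u⁻¹ * u) * f * ↑u⁻¹ := by simp only [hg, mul_assoc]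
      _ = g := by rw [u.inv_mul, mul_one, mul_assoc (u : R), hf.eq]
  have hπg : Ideal.Quotient.mk (Ring.jacobson R) g = Ideal.Quotient.mk _ f := by
    rw [hg, map_mul, map_mul, hπu, hπu', one_mul, mul_one]
  refine ⟨g * (1 - q), ?_, ?_, ?_, ?_⟩
  · have : (1 - q) * g = g := by rw [sub_mul, one_mul, hqg, sub_zero]
    rw [IsIdempotentElem, mul_assoc, ← mul_assoc (1 - q), this, ← mul_assoc, hgg]
  · rw [map_mul, map_sub, map_one, hπg, mul_sub, hxq, mul_one, sub_zero]
  · rw [mul_assoc, hq.one_sub_mul_self, mul_zero]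
  · rw [← mul_assoc, hqg, zero_mul]

theorem exists_orthogonalIdempotents_lift
    (hlift : ∀ x : R ⧸ Ring.jacobson R, IsIdempotentElem x →
      ∃ e : R, IsIdempotentElem e ∧ Ideal.Quotient.mk (Ring.jacobson R) e = x)
    {n : ℕ} {e : Fin n → R ⧸ Ring.jacobson R} (he : OrthogonalIdempotents e) :
    ∃ e' : Fin n → R, OrthogonalIdempotents e' ∧
      ∀ i, Ideal.Quotient.mk (Ring.jacobson R) (e' i) = e i := by
  induction n with
  | zero => exact ⟨0, ⟨finZeroElim, finZeroElim⟩, finZeroElim⟩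
  | succ n IH =>
    obtain ⟨e', h₁, h₂⟩ := IH (he.embedding (Fin.succEmb n))
    have h₂' (i) : Ideal.Quotient.mk (Ring.jacobson R) (e' i) = e i.succ := h₂ i
    obtain ⟨e₀, h₃, h₄, h₅, h₆⟩ := exists_orthogonal_lift hlift
      (h₁.isIdempotentElem_sum (s := Finset.univ)) (he.idem 0)
      (by simp [Finset.sum_mul, h₂', he.mul_eq])
      (by simp [Finset.mul_sum, h₂', he.mul_eq, eq_comm])
    refine ⟨_, (h₁.option _ h₃ h₅ h₆).embedding (finSuccEquiv n).toEmbedding, fun i ↦ ?_⟩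
    obtain ⟨_ | i, rfl⟩ := (finSuccEquiv n).symm.surjective i <;> simp [*]

/-- A complete orthogonal family lifts: for an orthogonal lift `e'`, the idempotent `1 - ∑ e'` lies
in `J(R)`, so it is zero. -/
theorem exists_completeOrthogonalIdempotents_lift
    (hlift : ∀ x : R ⧸ Ring.jacobson R, IsIdempotentElem x →
      ∃ e : R, IsIdempotentElem e ∧ Ideal.Quotient.mk (Ring.jacobson R) e = x)
    {n : ℕ} {e : Fin n → R ⧸ Ring.jacobson R} (he : CompleteOrthogonalIdempotents e) :
    ∃ e' : Fin n → R, CompleteOrthogonalIdempotents e' ∧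
      ∀ i, Ideal.Quotient.mk (Ring.jacobson R) (e' i) = e i := by
  obtain ⟨e', h, h'⟩ := exists_orthogonalIdempotents_lift hlift he.toOrthogonalIdempotents
  refine ⟨e', ⟨h, ?_⟩, h'⟩
  have hidem := (h.isIdempotentElem_sum (s := Finset.univ)).one_sub
  refine (sub_eq_zero.mp (eq_zero_of_isIdempotentElem_of_mem_jacobson hidem ?_)).symm
  rw [← Ideal.Quotient.eq_zero_iff_mem, map_sub, map_one, map_sum]
  simp only [h', he.complete, sub_self]

/-- A semisimple ring has a complete family of orthogonal idempotents generating simple left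
ideals: the components of `1` in a decomposition into simple left ideals. -/
theorem IsSemisimpleRing.exists_completeOrthogonalIdempotents (A : Type u) [Ring A]
    [IsSemisimpleRing A] : ∃ (n : ℕ) (e : Fin n → A), CompleteOrthogonalIdempotents e ∧
      ∀ i, IsLeftMinimal (e i) := by
  obtain ⟨n, S, φ, hS⟩ := IsSemisimpleModule.exists_linearEquiv_fin_dfinsupp A A
  let e : Fin n → A := fun i ↦ φ.symm (DFinsupp.single i (φ 1 i))
  have mul_e : ∀ x i, x * e i = φ.symm (DFinsupp.single i (φ x i)) := fun x i ↦ by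
    have hx : φ x = x • φ 1 := by rw [← map_smul, smul_eq_mul, mul_one]
    rw [← smul_eq_mul, ← map_smul, hx, ← DFinsupp.single_smul, DFinsupp.smul_apply]
  have φe : ∀ i, φ (e i) = DFinsupp.single i (φ 1 i) := fun i ↦ φ.apply_symm_apply _
  refine ⟨n, e, ⟨⟨fun i ↦ ?_, fun i j hij ↦ ?_⟩, ?_⟩, fun i ↦ ⟨fun h0 ↦ ?_, fun s hs ↦ ?_⟩⟩
  · rw [IsIdempotentElem, mul_e, φe, DFinsupp.single_eq_same]
  · change e i * e j = 0
    rw [mul_e, φe, DFinsupp.single_eq_of_ne hij.symm, DFinsupp.single_zero, map_zero]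
  · apply φ.injective
    rw [map_sum]
    simp only [φe]
    ext i
    rw [DFinsupp.finsetSum_apply, Finset.sum_eq_single i, DFinsupp.single_eq_same]
    · exact fun j _ hj ↦ by rw [DFinsupp.single_eq_of_ne hj.symm]
    · exact fun h ↦ absurd (Finset.mem_univ i) h
  · -- The component of `1` in `S i` is nonzero, since it generates the nonzero module `S i`.
    have h1 : φ 1 i = 0 := by
      have h1 := DFunLike.congr_fun (φe i) i
      rw [h0, map_zero, DFinsupp.single_eq_same] at h1
      exact h1.symm
    have := IsSimpleModule.nontrivial A (S i)
    obtain ⟨x, hx⟩ := exists_ne (0 : S i)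
    apply hx
    have h2 : φ (φ.symm (DFinsupp.single i x)) = φ.symm (DFinsupp.single i x) • φ 1 := by
      rw [← map_smul, smul_eq_mul, mul_one]
    rw [φ.apply_symm_apply] at h2
    have h3 := DFunLike.congr_fun h2 i
    rwa [DFinsupp.single_eq_same, DFinsupp.smul_apply, h1, smul_zero] at h3
  · rw [mul_e] at hs
    have hne : φ s i ≠ 0 := fun h0 ↦ hs (by rw [h0, DFinsupp.single_zero, map_zero])
    obtain ⟨t, ht⟩ := IsSimpleModule.toSpanSingleton_surjective A hne (φ 1 i)
    refine ⟨t, ?_⟩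
    rw [LinearMap.toSpanSingleton_apply] at ht
    rw [mul_e, ← smul_eq_mul, ← map_smul, ← DFinsupp.single_smul, ht]

/-- A semiperfect ring has a complete family of orthogonal local idempotents. -/
theorem IsSemiperfectRing.exists_completeOrthogonalIdempotents (hR : IsSemiperfectRing R) :
    ∃ (m : ℕ) (ε : Fin m → R), CompleteOrthogonalIdempotents ε ∧ ∀ j, IsLocalIdempotent (ε j) := by
  have := hR.1
  obtain ⟨n, e, he, hmin⟩ :=
    IsSemisimpleRing.exists_completeOrthogonalIdempotents (R ⧸ Ring.jacobson R)
  obtain ⟨ε, hε, hεe⟩ := exists_completeOrthogonalIdempotents_lift hR.2 he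
  exact ⟨n, ε, hε, fun j ↦ (isCornerLocal_of_isLeftMinimal (hε.idem j)
    ((hεe j).symm ▸ hmin j)).isLocalIdempotent⟩

/-- Choosing one idempotent from each isomorphism class of a complete family of local idempotents
gives a basic set. -/
theorem IsSemiperfectRing.exists_isBasicSet (hR : IsSemiperfectRing R) :
    ∃ (n : ℕ) (e : Fin n → R), IsBasicSet e := by
  obtain ⟨m, ε, hε, hloc⟩ := hR.exists_completeOrthogonalIdempotents
  let s : Setoid (Fin m) :=
    { r := fun i j ↦ Nonempty (principalRight (ε i) ≃ₗ[Rᵐᵒᵖ] principalRight (ε j))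
      iseqv := ⟨fun _ ↦ ⟨.refl _ _⟩, fun ⟨f⟩ ↦ ⟨f.symm⟩, fun ⟨f⟩ ⟨g⟩ ↦ ⟨f.trans g⟩⟩ }
  obtain ⟨n, ⟨c⟩⟩ := Finite.exists_equiv_fin (Quotient s)
  have hout : ∀ k, (⟦(c.symm k).out⟧ : Quotient s) = c.symm k := fun k ↦ Quotient.out_eq _
  refine ⟨n, fun k ↦ ε (c.symm k).out, m, ε, hε, hloc,
    ⟨⟨fun k ↦ (c.symm k).out, fun k k' h ↦ ?_⟩, fun _ ↦ rfl⟩, fun j ↦ ⟨c ⟦j⟧, ?_, fun k hk ↦ ?_⟩⟩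
  · apply c.symm.injective
    rw [← hout k, ← hout k']
    exact congrArg _ h
  · exact Quotient.exact ((c.symm_apply_apply ⟦j⟧).symm.trans (hout (c ⟦j⟧)).symm)
  · rw [← c.apply_symm_apply k, ← hout k]
    exact congrArg c (Quotient.sound hk).symm

end Existence

/-! ### Socles over semilocal rings -/

section Socle

theorem isSemisimpleModule_of_jacobson_smul_eq_zero {A M : Type*} [Ring A] [AddCommGroup M]
    [Module A M] [IsSemisimpleRing (A ⧸ Ring.jacobson A)]
    (h : ∀ j ∈ Ring.jacobson A, ∀ x : M, j • x = 0) : IsSemisimpleModule A M := by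
  have ht : Module.IsTorsionBySet A M (Ring.jacobson A) := fun x j ↦ h j j.2 x
  let _ := ht.module
  exact (ht.semilinearMap.isSemisimpleModule_iff_of_bijective Function.bijective_id).2
    inferInstance

theorem le_moduleSocle {A M : Type*} [Ring A] [AddCommGroup M] [Module A M]
    (N : Submodule A M) [IsSemisimpleModule A N] : N ≤ moduleSocle A M := by
  have : (⊤ : Submodule A N) ≤ (moduleSocle A M).comap N.subtype := by
    rw [← IsSemisimpleModule.sSup_simples_eq_top A N]
    refine sSup_le fun K hK ↦ Submodule.map_le_iff_le_comap.mp (le_sSup ?_)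
    have hK' : IsSimpleModule A K := hK
    exact .congr (Submodule.equivMapOfInjective N.subtype N.injective_subtype K).symm
  exact fun x hx ↦ this (Submodule.mem_top (x := ⟨x, hx⟩))

theorem map_moduleSocle {A M M' : Type*} [Ring A] [AddCommGroup M] [Module A M] [AddCommGroup M']
    [Module A M'] (φ : M ≃ₗ[A] M') :
    (moduleSocle A M).map φ.toLinearMap = moduleSocle A M' := by
  change Submodule.orderIsoMapComap φ (moduleSocle A M) = moduleSocle A M'
  rw [moduleSocle, moduleSocle, OrderIso.map_sSup_eq_sSup_symm_preimage]
  congr 1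
  ext N
  rw [Set.mem_preimage, Set.mem_ofPred_eq, Set.mem_ofPred_eq, isSimpleModule_iff_isAtom,
    isSimpleModule_iff_isAtom, OrderIso.isAtom_iff]

/-- Over a semilocal ring the socle of a module is the annihilator of the radical. -/
theorem mem_moduleSocle_iff {A M : Type*} [Ring A] [AddCommGroup M] [Module A M]
    [IsSemisimpleRing (A ⧸ Ring.jacobson A)] {x : M} :
    x ∈ moduleSocle A M ↔ ∀ j ∈ Ring.jacobson A, j • x = 0 := by
  constructor
  · intro hx j hj
    rw [moduleSocle, sSup_eq_iSup'] at hx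
    refine Submodule.iSup_induction _ (motive := fun y ↦ j • y = 0) hx (fun N y hy ↦ ?_)
      (smul_zero j) fun y z hy hz ↦ by rw [smul_add, hy, hz, add_zero]
    have : IsSimpleModule A N.1 := N.2
    have := IsSemisimpleModule.jacobson_le_annihilator A N.1 hj
    exact congrArg Subtype.val (Module.mem_annihilator.mp this ⟨y, hy⟩)
  · intro h
    have : IsSemisimpleModule A (Submodule.span A {x}) := by
      refine isSemisimpleModule_of_jacobson_smul_eq_zero fun j hj y ↦ Subtype.ext ?_
      obtain ⟨s, hs⟩ := Submodule.mem_span_singleton.mp y.2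
      rw [Submodule.coe_smul, ← hs, smul_smul]
      exact h _ (jacobson_mul_mem_right s hj)
    exact le_moduleSocle _ (Submodule.mem_span_singleton_self x)

variable {R : Type u} [Ring R]

theorem mem_leftSocle_iff [IsSemisimpleRing (R ⧸ Ring.jacobson R)] {x : R} :
    x ∈ leftSocle R ↔ ∀ j ∈ Ring.jacobson R, j * x = 0 :=
  mem_moduleSocle_iff

theorem mem_rightSocle_iff [h : IsSemisimpleRing (R ⧸ Ring.jacobson R)] {x : R} :
    x ∈ rightSocle R ↔ ∀ j ∈ Ring.jacobson R, x * j = 0 := by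
  have := isSemisimpleRing_op_quotient_jacobson h
  refine mem_moduleSocle_iff.trans ⟨fun h j hj ↦ h (op j) (op_mem_jacobson.mpr hj),
    fun h j hj ↦ ?_⟩
  obtain ⟨j, rfl⟩ := op_surjective j
  exact h j (op_mem_jacobson.mp hj)

theorem isSimpleModule_principalLeft_iff {a : R} :
    IsSimpleModule R (principalLeft a) ↔ IsLeftMinimal a := by
  have ha := Submodule.mem_span_singleton_self (R := R) a
  constructor
  · intro h
    have := IsSimpleModule.nontrivial R (principalLeft a)
    refine ⟨fun h0 ↦ ?_, fun s hs ↦ ?_⟩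
    · obtain ⟨x, hx⟩ := exists_ne (0 : principalLeft a)
      obtain ⟨t, ht⟩ := mem_principalLeft.mp x.2
      exact hx (Subtype.ext (by rw [← ht, h0, mul_zero]; rfl))
    · obtain ⟨t, ht⟩ := IsSimpleModule.toSpanSingleton_surjective R
        (m := (⟨s * a, (principalLeft a).smul_mem s ha⟩ : principalLeft a))
        (fun h0 ↦ hs (congrArg Subtype.val h0)) ⟨a, ha⟩
      exact ⟨t, congrArg Subtype.val ht⟩
  · intro h
    refine isSimpleModule_iff_toSpanSingleton_surjective.mpr
      ⟨⟨⟨a, ha⟩, 0, fun h0 ↦ h.1 (congrArg Subtype.val h0)⟩, fun x hx y ↦ ?_⟩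
    obtain ⟨s, hs⟩ := mem_principalLeft.mp x.2
    obtain ⟨r, hr⟩ := mem_principalLeft.mp y.2
    obtain ⟨t, ht⟩ := h.2 s (fun h0 ↦ hx (Subtype.ext (hs.symm.trans h0)))
    refine ⟨r * t, Subtype.ext ?_⟩
    change r * t * (x : R) = y
    rw [← hs, mul_assoc, ht, hr]

theorem Ideal.exists_eq_principalLeft_of_isSimpleModule {I : Ideal R} (hI : IsSimpleModule R I) :
    ∃ a, IsLeftMinimal a ∧ I = principalLeft a := by
  have := IsSimpleModule.nontrivial R I
  obtain ⟨x, hx⟩ := exists_ne (0 : I)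
  have hIx : I = principalLeft (x : R) := by
    refine le_antisymm (fun y hy ↦ ?_) ((Submodule.span_singleton_le_iff_mem _ _).mpr x.2)
    obtain ⟨t, ht⟩ := IsSimpleModule.toSpanSingleton_surjective R hx ⟨y, hy⟩
    exact mem_principalLeft.mpr ⟨t, congrArg Subtype.val ht⟩
  exact ⟨x, isSimpleModule_principalLeft_iff.mp (hIx ▸ hI), hIx⟩

end Socle

/-! ### Right ideals as left ideals of the opposite ring -/

section Opposite

variable (R : Type u) [Ring R]

/-- The right module `R` is the left regular module of `Rᵐᵒᵖ`. -/
def opModuleEquiv : R ≃ₗ[Rᵐᵒᵖ] Rᵐᵒᵖ where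
  __ := opAddEquiv
  map_smul' _ _ := rfl

/-- Right ideals of `R` are left ideals of `Rᵐᵒᵖ`. -/
def rightIdealEquiv : Submodule Rᵐᵒᵖ R ≃o Ideal Rᵐᵒᵖ :=
  Submodule.orderIsoMapComap (opModuleEquiv R)

variable {R}

theorem op_mem_rightIdealEquiv {I : Submodule Rᵐᵒᵖ R} {x : R} :
    op x ∈ rightIdealEquiv R I ↔ x ∈ I :=
  Submodule.mem_map_equiv I (e := opModuleEquiv R)

theorem isSimpleModule_rightIdealEquiv {I : Submodule Rᵐᵒᵖ R} :
    IsSimpleModule Rᵐᵒᵖ (rightIdealEquiv R I) ↔ IsSimpleModule Rᵐᵒᵖ I :=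
  ((opModuleEquiv R).submoduleMap I).symm.isSimpleModule_iff

theorem rightIdealEquiv_rightSocle : rightIdealEquiv R (rightSocle R) = leftSocle Rᵐᵒᵖ :=
  map_moduleSocle (opModuleEquiv R)

theorem rightIdealEquiv_jacobsonRight :
    rightIdealEquiv R (jacobsonRight R) = Ring.jacobson Rᵐᵒᵖ := by
  ext x
  obtain ⟨x, rfl⟩ := op_surjective x
  rw [op_mem_rightIdealEquiv, op_mem_jacobson]
  rfl

/-- Only `lr(I) ⊆ I` matters: the other inclusion always holds. -/
theorem isLeftDIdeal_iff {I : Ideal R} :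
    IsLeftDIdeal I ↔ ∀ z, (∀ x, (∀ i ∈ I, i * x = 0) → z * x = 0) → z ∈ I :=
  ⟨fun h _ hz ↦ h.le hz, fun h ↦ le_antisymm (fun z hz ↦ h z hz) fun _ hi _ hx ↦ hx _ hi⟩

theorem isRightDIdeal_iff {I : Submodule Rᵐᵒᵖ R} :
    IsRightDIdeal I ↔ ∀ z, (∀ x, (∀ i ∈ I, x * i = 0) → x * z = 0) → z ∈ I :=
  ⟨fun h _ hz ↦ h.le hz, fun h ↦ le_antisymm (fun z hz ↦ h z hz) fun _ hi _ hx ↦ hx _ hi⟩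

theorem isRightDIdeal_iff_op {I : Submodule Rᵐᵒᵖ R} :
    IsRightDIdeal I ↔ IsLeftDIdeal (rightIdealEquiv R I) := by
  simp only [isRightDIdeal_iff, isLeftDIdeal_iff, MulOpposite.forall, op_mem_rightIdealEquiv,
    ← op_mul, op_eq_zero_iff]

/-- All left ideals contained in the socle or containing the radical are D-ideals. -/
def LeftSocleAndTopDIdeals (R : Type u) [Ring R] : Prop :=
  (∀ I : Ideal R, I ≤ leftSocle R → IsLeftDIdeal I) ∧
    ∀ I : Ideal R, Ring.jacobson R ≤ I → IsLeftDIdeal I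

theorem socleAndTopDIdeals_iff :
    SocleAndTopDIdeals R ↔ LeftSocleAndTopDIdeals R ∧ LeftSocleAndTopDIdeals Rᵐᵒᵖ := by
  have hs : (∀ I : Submodule Rᵐᵒᵖ R, I ≤ rightSocle R → IsRightDIdeal I) ↔
      ∀ I : Ideal Rᵐᵒᵖ, I ≤ leftSocle Rᵐᵒᵖ → IsLeftDIdeal I := by
    rw [(rightIdealEquiv R).surjective.forall]
    simp only [isRightDIdeal_iff_op, ← rightIdealEquiv_rightSocle, OrderIso.le_iff_le]
  have ht : (∀ I : Submodule Rᵐᵒᵖ R, jacobsonRight R ≤ I → IsRightDIdeal I) ↔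
      ∀ I : Ideal Rᵐᵒᵖ, Ring.jacobson Rᵐᵒᵖ ≤ I → IsLeftDIdeal I := by
    rw [(rightIdealEquiv R).surjective.forall]
    simp only [isRightDIdeal_iff_op, ← rightIdealEquiv_jacobsonRight, OrderIso.le_iff_le]
  rw [SocleAndTopDIdeals, hs, ht, LeftSocleAndTopDIdeals, LeftSocleAndTopDIdeals]
  tauto

theorem isLeftDIdeal_principalLeft_iff {a : R} :
    IsLeftDIdeal (principalLeft a) ↔ ∀ z, (∀ x, a * x = 0 → z * x = 0) → ∃ t, z = t * a := by
  have ha : ∀ x, (∀ i ∈ principalLeft a, i * x = 0) ↔ a * x = 0 := fun x ↦ by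
    refine ⟨fun h ↦ h a (Submodule.mem_span_singleton_self a), fun h i hi ↦ ?_⟩
    obtain ⟨t, rfl⟩ := mem_principalLeft.mp hi
    rw [mul_assoc, h, mul_zero]
  refine isLeftDIdeal_iff.trans (forall_congr' fun z ↦ ?_)
  simp only [ha]
  rw [mem_principalLeft]
  simp only [eq_comm (a := z)]

theorem isLeftMinannihilator_iff :
    IsLeftMinannihilator R ↔ ∀ I : Ideal R, IsSimpleModule R I → IsLeftDIdeal I := by
  constructor
  · intro h I hI
    obtain ⟨a, ha, rfl⟩ := Ideal.exists_eq_principalLeft_of_isSimpleModule hI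
    exact isLeftDIdeal_principalLeft_iff.mpr (h a ha)
  · exact fun h a ha ↦ isLeftDIdeal_principalLeft_iff.mp
      (h _ (isSimpleModule_principalLeft_iff.mpr ha))

theorem isMinannihilatorRing_iff :
    IsMinannihilatorRing R ↔ IsLeftMinannihilator R ∧ IsRightMinannihilator R := by
  rw [IsMinannihilatorRing, isLeftMinannihilator_iff, ← isLeftMinannihilator_op,
    isLeftMinannihilator_iff]
  refine and_congr_right' ?_
  rw [(rightIdealEquiv R).surjective.forall]
  simp only [isSimpleModule_rightIdealEquiv, isRightDIdeal_iff_op]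

/-- A ring is left Kasch iff every maximal left ideal has a nonzero right annihilator. -/
theorem isLeftKasch_iff : IsLeftKasch R ↔ HasMaximalLeftAnnihilators R := by
  constructor
  · intro h L hL
    have : IsSimpleModule R (R ⧸ L) := isSimpleModule_iff_isCoatom.mpr hL.out
    obtain ⟨I, ⟨φ⟩⟩ := h (R ⧸ L)
    refine ⟨φ (Submodule.Quotient.mk 1), fun h0 ↦ ?_, fun x hx ↦ ?_⟩
    · have h1 : (Submodule.Quotient.mk 1 : R ⧸ L) = 0 :=
        φ.injective ((Subtype.ext h0).trans φ.map_zero.symm)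
      exact hL.ne_top ((Ideal.eq_top_iff_one L).mpr ((Submodule.Quotient.mk_eq_zero L).mp h1))
    · have h1 : x • (Submodule.Quotient.mk 1 : R ⧸ L) = 0 := by
        rw [← Submodule.Quotient.mk_smul, smul_eq_mul, mul_one]
        exact (Submodule.Quotient.mk_eq_zero L).mpr hx
      have h2 := congrArg (fun y ↦ (φ y : R)) h1
      simpa using h2
  · intro h T _ _ hT
    obtain ⟨L, hL, ⟨φ⟩⟩ := isSimpleModule_iff_quot_maximal.mp hT
    obtain ⟨b, hb, hLb⟩ := h L hL
    have hker : LinearMap.ker (LinearMap.toSpanSingleton R R b) = L := by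
      ext y
      exact ⟨fun hy ↦ hL.mem_of_mul_eq_zero hb hLb hy, fun hy ↦ hLb y hy⟩
    exact ⟨_, ⟨φ.trans ((Submodule.quotEquivOfEq _ _ hker.symm).trans
      (LinearMap.toSpanSingleton R R b).quotKerEquivRange)⟩⟩

theorem isRightKasch_iff : IsRightKasch R ↔ IsLeftKasch Rᵐᵒᵖ := by
  refine forall₄_congr fun T _ _ _ ↦ ?_
  rw [(rightIdealEquiv R).surjective.exists]
  refine exists_congr fun I ↦ ?_
  have e := (opModuleEquiv R).submoduleMap I
  exact ⟨fun ⟨φ⟩ ↦ ⟨φ.trans e⟩, fun ⟨φ⟩ ↦ ⟨φ.trans e.symm⟩⟩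

theorem isKaschRing_iff :
    IsKaschRing R ↔ HasMaximalLeftAnnihilators R ∧ HasMaximalLeftAnnihilators Rᵐᵒᵖ := by
  rw [IsKaschRing, isRightKasch_iff, isLeftKasch_iff, isLeftKasch_iff]

end Opposite

/-! ### D-ideals in the socle and above the radical -/

section DIdeals

variable {R : Type u} [Ring R]

/-- Over a semilocal ring every left ideal containing the radical is an intersection of maximal
left ideals. -/
theorem exists_isMaximal_of_notMem [IsSemisimpleRing (R ⧸ Ring.jacobson R)] {N : Ideal R}
    (hN : Ring.jacobson R ≤ N) {y : R} (hy : y ∉ N) :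
    ∃ L : Ideal R, L.IsMaximal ∧ N ≤ L ∧ y ∉ L := by
  have : IsSemisimpleModule R (R ⧸ N) := by
    refine isSemisimpleModule_of_jacobson_smul_eq_zero fun j hj x ↦ ?_
    obtain ⟨x, rfl⟩ := Submodule.Quotient.mk_surjective N x
    rw [← Submodule.Quotient.mk_smul, Submodule.Quotient.mk_eq_zero]
    exact hN (jacobson_mul_mem_right x hj)
  have hbot := IsSemisimpleModule.jacobson_eq_bot R (R ⧸ N)
  have hy' : (Submodule.Quotient.mk y : R ⧸ N) ∉ Module.jacobson R (R ⧸ N) := by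
    rw [hbot, Submodule.mem_bot, Submodule.Quotient.mk_eq_zero]
    exact hy
  rw [Module.jacobson, Submodule.mem_sInf] at hy'
  push Not at hy'
  obtain ⟨K, hK, hyK⟩ := hy'
  refine ⟨K.comap N.mkQ, ⟨(Submodule.isCoatom_comap_iff N.mkQ_surjective).mpr hK⟩, fun x hx ↦ ?_,
    hyK⟩
  rw [Submodule.mem_comap, Submodule.mkQ_apply, (Submodule.Quotient.mk_eq_zero N).mpr hx]
  exact zero_mem K

/-- The left ideals containing the radical are D-ideals exactly when the ring is left Kasch. -/
theorem hasMaximalLeftAnnihilators_iff [IsSemisimpleRing (R ⧸ Ring.jacobson R)] :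
    HasMaximalLeftAnnihilators R ↔ ∀ I : Ideal R, Ring.jacobson R ≤ I → IsLeftDIdeal I := by
  constructor
  · refine fun h I hI ↦ isLeftDIdeal_iff.mpr fun z hz ↦ by_contra fun hzI ↦ ?_
    obtain ⟨L, hL, hIL, hzL⟩ := exists_isMaximal_of_notMem hI hzI
    obtain ⟨b, hb, hLb⟩ := h L hL
    exact hzL (hL.mem_of_mul_eq_zero hb hLb (hz b fun i hi ↦ hLb i (hIL hi)))
  · intro h L hL
    by_contra! hcon
    refine hL.ne_top ((Ideal.eq_top_iff_one L).mpr (isLeftDIdeal_iff.mp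
      (h L (Ring.jacobson_le_of_isMaximal L)) 1 fun x hx ↦ ?_))
    rw [one_mul]
    by_contra hx0
    obtain ⟨i, hi, hix⟩ := hcon x hx0
    exact hix (hx i hi)

/-- Adding a simple left ideal `Ra` to a left D-ideal `I` gives a left D-ideal. If `a ∉ I`, some
`x ∈ r(I)` has `ax ≠ 0`, and `r(I) = r(I + Ra) + xR` because `aR` is simple. An element `z` of
`lr(I + Ra)` has `zx ∈ lr(ax) = Rax`, say `zx = tax`, and then `z - ta ∈ lr(I) = I`. -/
theorem IsLeftDIdeal.sup_principalLeft (hM : IsLeftMinannihilator R) {I : Ideal R}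
    (hI : IsLeftDIdeal I) {a : R} (ha : IsLeftMinimal a) (ha' : IsRightMinimal a) :
    IsLeftDIdeal (I ⊔ principalLeft a) := by
  rw [isLeftDIdeal_iff] at hI ⊢
  have haI : a ∈ I ⊔ principalLeft a :=
    Submodule.mem_sup_right (Submodule.mem_span_singleton_self a)
  intro z hz
  by_cases haI' : a ∈ I
  · have : I ⊔ principalLeft a = I :=
      sup_eq_left.mpr ((Submodule.span_singleton_le_iff_mem _ _).mpr haI')
    rw [this] at hz ⊢
    exact hI z hz
  · have hann : ∀ y, (∀ i ∈ I, i * y = 0) → a * y = 0 → z * y = 0 := by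
      refine fun y hy hay ↦ hz y fun i hi ↦ ?_
      obtain ⟨j, hj, k, hk, rfl⟩ := Submodule.mem_sup.mp hi
      obtain ⟨s, rfl⟩ := mem_principalLeft.mp hk
      rw [add_mul, hy j hj, mul_assoc, hay, mul_zero, add_zero]
    have hx : ∃ x, (∀ i ∈ I, i * x = 0) ∧ a * x ≠ 0 := by
      by_contra! hcon
      exact haI' (hI a hcon)
    obtain ⟨x, hxI, hax⟩ := hx
    obtain ⟨t, ht⟩ := hM (a * x) (ha.mul_right hax) (z * x) fun y hy ↦ by
      rw [mul_assoc]
      refine hann _ (fun i hi ↦ ?_) (by rwa [← mul_assoc])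
      rw [← mul_assoc, hxI i hi, zero_mul]
    have hmem : z - t * a ∈ I := hI _ fun y hy ↦ by
      obtain ⟨s, hs⟩ : ∃ s, a * y = a * x * s := by
        obtain ⟨s, hs⟩ := ha'.2 x hax
        exact ⟨s * y, by rw [← mul_assoc, hs]⟩
      have hzy : z * (y - x * s) = 0 := by
        refine hann _ (fun i hi ↦ ?_) ?_
        · rw [mul_sub, hy i hi, ← mul_assoc, hxI i hi, zero_mul, sub_zero]
        · rw [mul_sub, hs, mul_assoc, sub_self]
      rw [mul_sub, sub_eq_zero] at hzy
      rw [sub_mul, hzy, mul_assoc t, hs, ← mul_assoc z, ht]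
      simp only [mul_assoc, sub_self]
    rw [← sub_add_cancel z (t * a)]
    exact add_mem (Submodule.mem_sup_left hmem)
      (Submodule.mem_sup_right (mem_principalLeft.mpr ⟨t, rfl⟩))

theorem isLeftDIdeal_span_finset (hM : IsLeftMinannihilator R)
    (hlr : ∀ a : R, IsLeftMinimal a → IsRightMinimal a) (F : Finset R)
    (hF : ∀ a ∈ F, IsLeftMinimal a) : IsLeftDIdeal (Ideal.span (F : Set R)) := by
  classical
  induction F using Finset.induction_on with
  | empty =>
    refine isLeftDIdeal_iff.mpr fun z hz ↦ ?_
    have := hz 1 (by simp)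
    rw [mul_one] at this
    exact this ▸ zero_mem _
  | insert a F _ ih =>
    rw [Finset.coe_insert, Ideal.span_insert, sup_comm]
    exact (ih fun b hb ↦ hF b (Finset.mem_insert_of_mem hb)).sup_principalLeft hM
      (hF a (Finset.mem_insert_self a F)) (hlr a (hF a (Finset.mem_insert_self a F)))

/-- Left ideals containing the radical of a semilocal ring satisfy the descending chain
condition. -/
theorem exists_minimal_of_jacobson_le {ι : Type*} [Nonempty ι]
    [IsSemisimpleRing (R ⧸ Ring.jacobson R)] (N : ι → Ideal R)
    (hN : ∀ i, Ring.jacobson R ≤ N i) : ∃ i, ∀ j, N j ≤ N i → N j = N i := by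
  have : IsSemisimpleModule R (R ⧸ Ring.jacobson R) :=
    isSemisimpleModule_of_jacobson_smul_eq_zero fun j hj x ↦ by
      obtain ⟨x, rfl⟩ := Submodule.Quotient.mk_surjective _ x
      rw [← Submodule.Quotient.mk_smul, Submodule.Quotient.mk_eq_zero]
      exact jacobson_mul_mem_right x hj
  have hart : IsArtinian R (R ⧸ Ring.jacobson R) := inferInstance
  let f : ι → Submodule R (R ⧸ Ring.jacobson R) := fun i ↦
    Submodule.map (Ring.jacobson R).mkQ (N i)
  have hf : ∀ i, Submodule.comap (Ring.jacobson R).mkQ (f i) = N i := fun i ↦ by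
    rw [Submodule.comap_map_mkQ, sup_eq_right.mpr (hN i)]
  obtain ⟨_, ⟨i, rfl⟩, hi⟩ := IsArtinian.set_has_minimal (Set.range f) (Set.range_nonempty f)
  refine ⟨i, fun j hj ↦ ?_⟩
  rw [← hf i, ← hf j]
  congr 1
  exact ((Submodule.map_mono hj).lt_or_eq).resolve_left (hi _ ⟨j, rfl⟩)

/-- The radical annihilates simple left ideals: if `t(ja) = a` then the unit `1 - tj` kills `a`. -/
theorem IsLeftMinimal.jacobson_mul_eq_zero {a j : R} (ha : IsLeftMinimal a)
    (hj : j ∈ Ring.jacobson R) : j * a = 0 := by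
  by_contra hja
  obtain ⟨t, ht⟩ := ha.2 j hja
  refine ha.1 ((isUnit_one_add_of_mem_jacobson
    ((Ring.jacobson R).neg_mem (jacobson_mul_mem_left t hj))).mul_right_eq_zero.mp ?_)
  rw [add_mul, neg_mul, mul_assoc, ht, one_mul, add_neg_cancel]

theorem IsRightMinimal.mul_jacobson_eq_zero {a j : R} (ha : IsRightMinimal a)
    (hj : j ∈ Ring.jacobson R) : a * j = 0 :=
  op_injective ((isLeftMinimal_op.mpr ha).jacobson_mul_eq_zero (op_mem_jacobson.mpr hj))

/-- A left ideal inside the socle is spanned by elements generating simple left ideals. -/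
theorem le_of_forall_isLeftMinimal [IsSemisimpleRing (R ⧸ Ring.jacobson R)] {I K : Ideal R}
    (hI : I ≤ leftSocle R) (h : ∀ a ∈ I, IsLeftMinimal a → a ∈ K) : I ≤ K := by
  have : IsSemisimpleModule R I := isSemisimpleModule_of_jacobson_smul_eq_zero fun j hj x ↦
    Subtype.ext (mem_leftSocle_iff.mp (hI x.2) j hj)
  have htop : (⊤ : Submodule R I) ≤ Submodule.comap I.subtype K := by
    rw [← IsSemisimpleModule.sSup_simples_eq_top R I]
    refine sSup_le fun S hS ↦ Submodule.map_le_iff_le_comap.mp ?_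
    have hS' : IsSimpleModule R S := hS
    obtain ⟨a, ha, haS⟩ := Ideal.exists_eq_principalLeft_of_isSimpleModule
      (.congr (Submodule.equivMapOfInjective I.subtype I.injective_subtype S).symm)
    have haI : a ∈ I := by
      have : a ∈ Submodule.map I.subtype S := haS ▸ Submodule.mem_span_singleton_self a
      exact Submodule.map_subtype_le I S this
    rw [haS]
    exact (Submodule.span_singleton_le_iff_mem _ _).mpr (h a haI ha)
  exact fun x hx ↦ htop (Submodule.mem_top (x := ⟨x, hx⟩))

/-- A left ideal `I` inside the socle is a D-ideal: by the descending chain condition on right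
ideals containing the radical, a finite set `F` of generators of simple left ideals in `I` has
`r(F) = r(I)`, so `lr(I) = lr(F)` is the span of `F`. -/
theorem isLeftDIdeal_of_le_leftSocle [hss : IsSemisimpleRing (R ⧸ Ring.jacobson R)]
    (hM : IsLeftMinannihilator R) (hlr : ∀ a : R, IsLeftMinimal a → IsRightMinimal a)
    {I : Ideal R} (hI : I ≤ leftSocle R) : IsLeftDIdeal I := by
  classical
  have := isSemisimpleRing_op_quotient_jacobson hss
  let ι := {F : Finset R // ∀ a ∈ F, a ∈ I ∧ IsLeftMinimal a}
  have : Nonempty ι := ⟨∅, by simp⟩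
  obtain ⟨⟨F, hF⟩, hmin⟩ := exists_minimal_of_jacobson_le
    (fun F : ι ↦ rightIdealEquiv R (rightAnn (F.1 : Set R))) fun F j hj ↦ by
      obtain ⟨j, rfl⟩ := op_surjective j
      exact op_mem_rightIdealEquiv.mpr fun a ha ↦
        (hlr a (F.2 a ha).2).mul_jacobson_eq_zero (op_mem_jacobson.mp hj)
  have hD := isLeftDIdeal_iff.mp (isLeftDIdeal_span_finset hM hlr F fun a ha ↦ (hF a ha).2)
  refine isLeftDIdeal_iff.mpr fun z hz ↦
    (Ideal.span_le.mpr fun a ha ↦ (hF a ha).1 : Ideal.span (F : Set R) ≤ I) (hD z fun y hy ↦ ?_)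
  have hyF : y ∈ rightAnn (F : Set R) := fun a ha ↦ hy a (Ideal.subset_span ha)
  have hIy : I ≤ leftAnn {y} := le_of_forall_isLeftMinimal hI fun a haI ha ↦ by
    have heq := hmin ⟨insert a F, fun b hb ↦ by
      rcases Finset.mem_insert.mp hb with rfl | hb
      · exact ⟨haI, ha⟩
      · exact hF b hb⟩ ((rightIdealEquiv R).monotone fun x hx b hb ↦
        hx b (Finset.mem_insert_of_mem hb))
    have hya : y ∈ rightAnn ((insert a F : Finset R) : Set R) := by
      rwa [(rightIdealEquiv R).injective heq]
    rintro _ rfl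
    exact hya a (Finset.mem_insert_self a F)
  exact hz y fun i hi ↦ hIy hi y rfl

/-- In a Kasch minannihilator ring, `Ra` is simple if and only if `aR` is. -/
theorem isLeftMinimal_iff_isRightMinimal (hK : HasMaximalLeftAnnihilators R)
    (hK' : HasMaximalLeftAnnihilators Rᵐᵒᵖ) (hM : IsLeftMinannihilator R)
    (hM' : IsRightMinannihilator R) (a : R) : IsLeftMinimal a ↔ IsRightMinimal a := by
  refine ⟨fun h ↦ ?_, fun h ↦ h.isLeftMinimal hK hM'⟩
  have := (isRightMinimal_op.mpr h).isLeftMinimal hK' (isRightMinannihilator_op.mpr hM)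
  rwa [isLeftMinimal_op] at this

theorem LeftSocleAndTopDIdeals.of_minannihilator [IsSemisimpleRing (R ⧸ Ring.jacobson R)]
    (hK : HasMaximalLeftAnnihilators R) (hM : IsLeftMinannihilator R)
    (hlr : ∀ a : R, IsLeftMinimal a → IsRightMinimal a) : LeftSocleAndTopDIdeals R :=
  ⟨fun _ ↦ isLeftDIdeal_of_le_leftSocle hM hlr, hasMaximalLeftAnnihilators_iff.mp hK⟩

theorem LeftSocleAndTopDIdeals.minannihilator [IsSemisimpleRing (R ⧸ Ring.jacobson R)]
    (h : LeftSocleAndTopDIdeals R) : HasMaximalLeftAnnihilators R ∧ IsLeftMinannihilator R :=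
  ⟨hasMaximalLeftAnnihilators_iff.mpr h.2, isLeftMinannihilator_iff.mpr fun I hI ↦
    h.1 I (le_sSup hI)⟩

/-- Being a Kasch minannihilator ring is equivalent to the D-ideal conditions: ideals containing the
radical are governed by the Kasch condition, ideals inside the socle by the minannihilator
condition once `Ra` and `aR` are known to be simple together. -/
theorem kasch_minannihilator_iff [hss : IsSemisimpleRing (R ⧸ Ring.jacobson R)] :
    IsKaschRing R ∧ IsMinannihilatorRing R ↔ SocleAndTopDIdeals R := by
  have := isSemisimpleRing_op_quotient_jacobson hss
  rw [isKaschRing_iff, isMinannihilatorRing_iff, socleAndTopDIdeals_iff]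
  constructor
  · rintro ⟨⟨hK, hK'⟩, hM, hM'⟩
    have hlr := isLeftMinimal_iff_isRightMinimal hK hK' hM hM'
    refine ⟨.of_minannihilator hK hM fun a ↦ (hlr a).mp,
      .of_minannihilator hK' (isLeftMinannihilator_op.mpr hM') fun a ↦ ?_⟩
    obtain ⟨a, rfl⟩ := op_surjective a
    rw [isLeftMinimal_op, isRightMinimal_op]
    exact (hlr a).mpr
  · rintro ⟨h, h'⟩
    exact ⟨⟨h.minannihilator.1, h'.minannihilator.1⟩, h.minannihilator.2,
      isLeftMinannihilator_op.mp h'.minannihilator.2⟩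

/-- If `Ra` and `aR` are always simple together then the two socles coincide: each is spanned by
such elements `a`, and `Ja = 0 = aJ`. -/
theorem coe_leftSocle_eq_coe_rightSocle [hss : IsSemisimpleRing (R ⧸ Ring.jacobson R)]
    (h : ∀ a : R, IsLeftMinimal a ↔ IsRightMinimal a) :
    (leftSocle R : Set R) = (rightSocle R : Set R) := by
  have := isSemisimpleRing_op_quotient_jacobson hss
  ext x
  constructor
  · intro hx
    refine mem_rightSocle_iff.mpr fun j hj ↦ ?_
    exact le_of_forall_isLeftMinimal (K := leftAnn (Ring.jacobson R)) le_rfl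
      (fun a _ ha j hj ↦ ((h a).mp ha).mul_jacobson_eq_zero hj) hx j hj
  · intro hx
    refine mem_leftSocle_iff.mpr fun j hj ↦ ?_
    have hx' : op x ∈ leftSocle Rᵐᵒᵖ := by
      rw [← rightIdealEquiv_rightSocle]
      exact op_mem_rightIdealEquiv.mpr hx
    have := le_of_forall_isLeftMinimal (K := leftAnn (Ring.jacobson Rᵐᵒᵖ)) le_rfl
      (fun a _ ha j hj ↦ by
        obtain ⟨a, rfl⟩ := op_surjective a
        rw [isLeftMinimal_op, ← h, ← isRightMinimal_op] at ha
        exact ha.mul_jacobson_eq_zero hj) hx'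
    exact op_injective (this (op j) (op_mem_jacobson.mpr hj))

end DIdeals

/-! ### Anti-isomorphisms of submodule lattices -/

section Lattice

/-- Two families of mutually inverse order-reversing maps, between the submodules above `N₀` and
the submodules below `K₀`, as an anti-isomorphism of lattices of submodules. -/
theorem exists_orderIso_dual {A B M M' : Type*} [Ring A] [Ring B] [AddCommGroup M] [Module A M]
    [AddCommGroup M'] [Module B M'] {N₀ : Submodule A M} {K₀ : Submodule B M'}
    {f : Submodule A M → Submodule B M'} {g : Submodule B M' → Submodule A M}
    (hf : Antitone f) (hg : Antitone g) (hfK : ∀ N, N₀ ≤ N → f N ≤ K₀)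
    (hgN : ∀ K, K ≤ K₀ → N₀ ≤ g K) (hgf : ∀ N, N₀ ≤ N → g (f N) = N)
    (hfg : ∀ K, K ≤ K₀ → f (g K) = K) :
    ∃ φ : Submodule A (M ⧸ N₀) ≃o (Submodule B K₀)ᵒᵈ,
      (∀ N, (OrderDual.ofDual (φ N)).map K₀.subtype = f (N.comap N₀.mkQ)) ∧
      ∀ K, (φ.symm (OrderDual.toDual K)).comap N₀.mkQ = g (K.map K₀.subtype) := by
  have le_comap : ∀ N : Submodule A (M ⧸ N₀), N₀ ≤ N.comap N₀.mkQ := fun N ↦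
    Submodule.le_comap_mkQ N₀ N
  let F : Submodule A (M ⧸ N₀) → (Submodule B K₀)ᵒᵈ := fun N ↦
    OrderDual.toDual ((f (N.comap N₀.mkQ)).comap K₀.subtype)
  let G : (Submodule B K₀)ᵒᵈ → Submodule A (M ⧸ N₀) := fun K ↦
    (g ((OrderDual.ofDual K).map K₀.subtype)).map N₀.mkQ
  have hF : ∀ N, (OrderDual.ofDual (F N)).map K₀.subtype = f (N.comap N₀.mkQ) := fun N ↦ by
    change ((f (N.comap N₀.mkQ)).comap K₀.subtype).map K₀.subtype = _
    rw [Submodule.map_comap_subtype, inf_eq_right.mpr (hfK _ (le_comap N))]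
  have hG : ∀ K, (G K).comap N₀.mkQ = g ((OrderDual.ofDual K).map K₀.subtype) := fun K ↦ by
    change ((g _).map N₀.mkQ).comap N₀.mkQ = _
    rw [Submodule.comap_map_mkQ, sup_eq_right.mpr (hgN _ (Submodule.map_subtype_le K₀ _))]
  have hGF : ∀ N, G (F N) = N := fun N ↦ by
    apply Submodule.comap_injective_of_surjective N₀.mkQ_surjective
    rw [hG, hF, hgf _ (le_comap N)]
  have hFG : ∀ K, F (G K) = K := fun K ↦ by
    apply OrderDual.ofDual.injective
    apply Submodule.map_injective_of_injective K₀.injective_subtype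
    rw [hF, hG, hfg _ (Submodule.map_subtype_le K₀ _)]
  have hFmono : Monotone F := fun N N' h ↦
    OrderDual.toDual_le_toDual.mpr (Submodule.comap_mono (hf (Submodule.comap_mono h)))
  have hGmono : Monotone G := fun K K' h ↦
    Submodule.map_mono (hg (Submodule.map_mono (OrderDual.ofDual_le_ofDual.mpr h)))
  exact ⟨⟨⟨F, G, hGF, hFG⟩, fun {N N'} ↦
    ⟨fun h ↦ by rw [← hGF N, ← hGF N']; exact hGmono h, fun h ↦ hFmono h⟩⟩, hF,
    fun K ↦ hG (OrderDual.toDual K)⟩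

/-- Conversely, an anti-isomorphism induced by two maps makes these maps mutually inverse. -/
theorem inverse_of_orderIso_dual {A B M M' : Type*} [Ring A] [Ring B] [AddCommGroup M] [Module A M]
    [AddCommGroup M'] [Module B M'] {N₀ : Submodule A M} {K₀ : Submodule B M'}
    {f : Submodule A M → Submodule B M'} {g : Submodule B M' → Submodule A M}
    (φ : Submodule A (M ⧸ N₀) ≃o (Submodule B K₀)ᵒᵈ)
    (h : ∀ N, (OrderDual.ofDual (φ N)).map K₀.subtype = f (N.comap N₀.mkQ))
    (h' : ∀ K, (φ.symm (OrderDual.toDual K)).comap N₀.mkQ = g (K.map K₀.subtype)) :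
    (∀ N, N₀ ≤ N → g (f N) = N) ∧ ∀ K, K ≤ K₀ → f (g K) = K := by
  refine ⟨fun N hN ↦ ?_, fun K hK ↦ ?_⟩
  · have hNm : (N.map N₀.mkQ).comap N₀.mkQ = N := by
      rw [Submodule.comap_map_mkQ, sup_eq_right.mpr hN]
    have h2 := h' (OrderDual.ofDual (φ (N.map N₀.mkQ)))
    rw [h, OrderDual.toDual_ofDual, φ.symm_apply_apply, hNm] at h2
    exact h2.symm
  · have hKm : (K.comap K₀.subtype).map K₀.subtype = K := by
      rw [Submodule.map_comap_subtype, inf_eq_right.mpr hK]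
    have h2 := h (φ.symm (OrderDual.toDual (K.comap K₀.subtype)))
    rw [h', φ.apply_symm_apply, OrderDual.ofDual_toDual, hKm] at h2
    exact h2.symm

variable {R : Type u} [Ring R]

theorem leftAnn_anti {X Y : Set R} (h : X ⊆ Y) : leftAnn Y ≤ leftAnn X :=
  fun _ ha x hx ↦ ha x (h hx)

theorem rightAnn_anti {X Y : Set R} (h : X ⊆ Y) : rightAnn Y ≤ rightAnn X :=
  fun _ ha x hx ↦ ha x (h hx)

/-- The lattice anti-isomorphisms given by annihilators restate the D-ideal conditions. They also
force `r(N) ⊆ S_r` for `N ⊇ J(R)`, which holds because `S_l = S_r`. -/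
theorem socleAndTopDIdeals_iff_annihilator [hss : IsSemisimpleRing (R ⧸ Ring.jacobson R)] :
    SocleAndTopDIdeals R ↔ AnnLeftTopRightSocle R ∧ AnnLeftSocleRightTop R := by
  constructor
  · intro h
    obtain ⟨hK, hM⟩ := kasch_minannihilator_iff.mpr h
    rw [isKaschRing_iff] at hK
    rw [isMinannihilatorRing_iff] at hM
    have hS := coe_leftSocle_eq_coe_rightSocle
      (isLeftMinimal_iff_isRightMinimal hK.1 hK.2 hM.1 hM.2)
    have hSl : ∀ x, x ∈ rightSocle R → x ∈ leftSocle R := fun x hx ↦ hS.ge hx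
    have hSr : ∀ x, x ∈ leftSocle R → x ∈ rightSocle R := fun x hx ↦ hS.le hx
    obtain ⟨hrs, hls, hrt, hlt⟩ := h
    refine ⟨exists_orderIso_dual (f := fun N : Ideal R ↦ rightAnn (N : Set R))
      (g := fun K : Submodule Rᵐᵒᵖ R ↦ leftAnn (K : Set R)) (fun _ _ h ↦ rightAnn_anti h) (fun _ _ h ↦ leftAnn_anti h)
      (fun N hN x hx ↦ hSr x (mem_leftSocle_iff.mpr fun j hj ↦ hx j (hN hj)))
      (fun K hK j hj x hx ↦ mem_leftSocle_iff.mp (hSl x (hK hx)) j hj)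
      (fun N hN ↦ hlt N hN) (fun K hK ↦ hrs K hK), ?_⟩
    obtain ⟨φ, h1, h2⟩ := exists_orderIso_dual (N₀ := jacobsonRight R) (K₀ := leftSocle R)
      (f := fun N ↦ leftAnn (N : Set R))
      (g := fun K ↦ rightAnn (K : Set R)) (fun _ _ h ↦ leftAnn_anti h)
      (fun _ _ h ↦ rightAnn_anti h)
      (fun N hN x hx ↦ hSl x (mem_rightSocle_iff.mpr fun j hj ↦ hx j (hN hj)))
      (fun K hK j hj x hx ↦ mem_rightSocle_iff.mp (hSr x (hK hx)) j hj)
      (fun N hN ↦ hrt N hN) (fun K hK ↦ hls K hK)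
    exact ⟨(OrderIso.dualDual _).trans φ.symm.dual, h2, h1⟩
  · rintro ⟨⟨φ, hφ, hφ'⟩, ψ, hψ, hψ'⟩
    obtain ⟨hlt, hrs⟩ := inverse_of_orderIso_dual (f := fun N : Ideal R ↦ rightAnn (N : Set R))
      (g := fun K : Submodule Rᵐᵒᵖ R ↦ leftAnn (K : Set R)) φ hφ hφ'
    obtain ⟨hrt, hls⟩ := inverse_of_orderIso_dual
      (f := fun N : Submodule Rᵐᵒᵖ R ↦ leftAnn (N : Set R))
      (g := fun K : Ideal R ↦ rightAnn (K : Set R)) (ψ.symm.trans (OrderIso.dualDual _)).dual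
      hψ' hψ
    exact ⟨hrs, hls, hrt, hlt⟩

end Lattice

/-! ### Tops of principal modules -/

section LocalModule

variable {A M M' : Type*} [Ring A] [AddCommGroup M] [Module A M] [AddCommGroup M'] [Module A M']

theorem LinearEquiv.nonempty_moduleTop_equiv (φ : M ≃ₗ[A] M') :
    Nonempty (ModuleTop A M ≃ₗ[A] ModuleTop A M') :=
  ⟨Submodule.Quotient.equiv _ _ φ (Module.map_jacobson_of_bijective φ.bijective)⟩

theorem LinearEquiv.nonempty_moduleSocle_equiv (φ : M ≃ₗ[A] M') :
    Nonempty (moduleSocle A M ≃ₗ[A] moduleSocle A M') :=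
  ⟨(φ.submoduleMap _).trans (LinearEquiv.ofEq _ _ (map_moduleSocle φ))⟩

/-- A largest proper submodule is the radical and the only maximal submodule. -/
theorem isCoatom_jacobson_of_forall_le {K : Submodule A M} (hK : K ≠ ⊤)
    (h : ∀ N : Submodule A M, N ≠ ⊤ → N ≤ K) :
    IsCoatom (Module.jacobson A M) ∧ ∀ N, IsCoatom N → N = Module.jacobson A M := by
  have hco : IsCoatom K := ⟨hK, fun N hN ↦ by_contra fun hne ↦ (h N hne).not_gt hN⟩
  have huniq : ∀ N, IsCoatom N → N = K := fun N hN ↦ ((hN.le_iff_eq hK).mp (h N hN.1)).symm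
  have hj : Module.jacobson A M = K :=
    le_antisymm (sInf_le hco) (le_sInf fun N hN ↦ (huniq N hN).ge)
  rw [hj]
  exact ⟨hco, huniq⟩

variable {R : Type u} [Ring R]

/-- For a local idempotent `e`, the radical of `Re` is its only maximal submodule, since
`Re ∩ J(R)` is the largest proper submodule. -/
theorem IsCornerLocal.jacobson_principalLeft {e : R} (h : IsCornerLocal e) :
    IsCoatom (Module.jacobson R (principalLeft e)) ∧
      ∀ N : Submodule R (principalLeft e), IsCoatom N → N = Module.jacobson R (principalLeft e) := by
  have he := Submodule.mem_span_singleton_self (R := R) e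
  refine isCoatom_jacobson_of_forall_le
    (K := Submodule.comap (principalLeft e).subtype (Ring.jacobson R))
    (fun htop ↦ h.notMem (htop.ge (Submodule.mem_top (x := ⟨e, he⟩)))) fun N hN x hx ↦ ?_
  by_contra hxJ
  obtain ⟨t, ht⟩ := h.exists_mul_eq (h.idem.mem_principalLeft.mp x.2) hxJ
  refine hN (eq_top_iff.mpr fun y _ ↦ ?_)
  have : y = ((y : R) * t) • x := Subtype.ext <| by
    change (y : R) = y * t * x
    rw [mul_assoc, ht, h.idem.mem_principalLeft.mp y.2]
  exact this ▸ N.smul_mem _ hx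

theorem IsCornerLocal.isSimpleModule_top {e : R} (h : IsCornerLocal e) :
    IsSimpleModule R (ModuleTop R (principalLeft e)) :=
  isSimpleModule_iff_isCoatom.mpr h.jacobson_principalLeft.1

theorem IsCornerLocal.nonempty_top_equiv {e : R} (h : IsCornerLocal e) {T : Type*}
    [AddCommGroup T] [Module R T] [IsSimpleModule R T] {f : principalLeft e →ₗ[R] T}
    (hf : Function.Surjective f) : Nonempty (ModuleTop R (principalLeft e) ≃ₗ[R] T) :=
  ⟨(Submodule.quotEquivOfEq _ _
    (h.jacobson_principalLeft.2 _ (LinearMap.isCoatom_ker_of_surjective hf)).symm).trans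
    (f.quotKerEquivOfSurjective hf)⟩

theorem exists_smul_ne_zero_of_sum_eq_one {T : Type*} [AddCommGroup T] [Module R T] {m : ℕ}
    {ε : Fin m → R} (hε : ∑ j, ε j = 1) {t : T} (ht : t ≠ 0) : ∃ j, ε j • t ≠ 0 := by
  by_contra! h
  apply ht
  rw [← one_smul R t, ← hε, Finset.sum_smul, Finset.sum_eq_zero fun j _ ↦ h j]

theorem exists_mul_ne_zero_of_sum_eq_one {m : ℕ} {ε : Fin m → R} (hε : ∑ j, ε j = 1) {a : R}
    (ha : a ≠ 0) : ∃ j, a * ε j ≠ 0 := by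
  by_contra! h
  apply ha
  rw [← mul_one a, ← hε, Finset.mul_sum, Finset.sum_eq_zero fun j _ ↦ h j]

/-- Every simple module is the top of one of the principal modules `Reₖ`. -/
theorem exists_nonempty_top_equiv {n m : ℕ} {ε : Fin m → R} {e : Fin n → R}
    (hε : ∑ j, ε j = 1) (he : ∀ k, IsCornerLocal (e k))
    (hεe : ∀ j, ∃ k, IdempotentIso (ε j) (e k)) (T : Type*) [AddCommGroup T] [Module R T]
    [IsSimpleModule R T] : ∃ k, Nonempty (ModuleTop R (principalLeft (e k)) ≃ₗ[R] T) := by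
  have := IsSimpleModule.nontrivial R T
  obtain ⟨t, ht⟩ := exists_ne (0 : T)
  obtain ⟨j, hj⟩ := exists_smul_ne_zero_of_sum_eq_one hε ht
  obtain ⟨k, a, b, -, hb, hab, -⟩ := hεe j
  have hk : e k • b • t ≠ 0 := fun h0 ↦ hj <| by
    have : e k * b = b := by rw [← hb, ← mul_assoc, ← mul_assoc, (he k).idem.eq]
    rw [smul_smul, this] at h0
    rw [← hab, mul_smul, h0, smul_zero]
  refine ⟨k, (he k).nonempty_top_equiv
    (f := (LinearMap.toSpanSingleton R T (b • t)).comp (principalLeft (e k)).subtype)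
    (LinearMap.surjective_of_ne_zero fun h0 ↦ hk ?_)⟩
  exact LinearMap.congr_fun h0 ⟨e k, Submodule.mem_span_singleton_self _⟩

end LocalModule

/-! ### Simple socles of principal left ideals -/

section SimpleSocle

variable {R : Type u} [Ring R]

/-- The part `{a ∈ Re | Ja = 0}` of `Re` is generated by each of its nonzero elements. Over a
semilocal ring: the socle of `Re` is simple or zero. -/
def HasSimpleLeftSocle (e : R) : Prop :=
  ∀ a b, a * e = a → a ≠ 0 → (∀ j ∈ Ring.jacobson R, j * a = 0) →
    b * e = b → (∀ j ∈ Ring.jacobson R, j * b = 0) → ∃ t, t * a = b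

/-- The part `{a ∈ eR | aJ = 0}` of `eR` is generated by each of its nonzero elements. Over a
semilocal ring: the socle of `eR` is simple or zero. -/
def HasSimpleRightSocle (e : R) : Prop :=
  ∀ a b, e * a = a → a ≠ 0 → (∀ j ∈ Ring.jacobson R, a * j = 0) →
    e * b = b → (∀ j ∈ Ring.jacobson R, b * j = 0) → ∃ t, a * t = b

theorem hasSimpleLeftSocle_op {e : R} : HasSimpleLeftSocle (op e) ↔ HasSimpleRightSocle e := by
  simp only [HasSimpleLeftSocle, HasSimpleRightSocle, MulOpposite.forall, MulOpposite.exists,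
    ← op_mul, ne_eq, op_eq_zero_iff, op_inj, op_mem_jacobson]

theorem hasSimpleRightSocle_op {e : R} : HasSimpleRightSocle (op e) ↔ HasSimpleLeftSocle e := by
  simp only [HasSimpleLeftSocle, HasSimpleRightSocle, MulOpposite.forall, MulOpposite.exists,
    ← op_mul, ne_eq, op_eq_zero_iff, op_inj, op_mem_jacobson]

theorem IdempotentIso.op {e f : R} (h : IdempotentIso e f) : IdempotentIso (op e) (op f) := by
  obtain ⟨a, b, ha, hb, hab, hba⟩ := h
  refine ⟨MulOpposite.op b, MulOpposite.op a, ?_, ?_, ?_, ?_⟩ <;>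
    simp only [← op_mul, ← mul_assoc, ha, hb, hab, hba]

theorem HasSimpleLeftSocle.of_idempotentIso {e f : R} (hf : HasSimpleLeftSocle f)
    (hff : IsIdempotentElem f) (h : IdempotentIso e f) : HasSimpleLeftSocle e := by
  obtain ⟨u, v, hu, -, huv, -⟩ := h
  have huf : u * f = u := by rw [← hu, mul_assoc, hff.eq]
  intro a b ha ha0 haJ hb hbJ
  obtain ⟨t, ht⟩ := hf (a * u) (b * u) (by rw [mul_assoc, huf])
    (fun h0 ↦ ha0 (by rw [← ha, ← huv, ← mul_assoc, h0, zero_mul]))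
    (fun j hj ↦ by rw [← mul_assoc, haJ j hj, zero_mul]) (by rw [mul_assoc, huf])
    (fun j hj ↦ by rw [← mul_assoc, hbJ j hj, zero_mul])
  refine ⟨t, ?_⟩
  rw [← ha, ← hb, ← huv, ← mul_assoc, ← mul_assoc, ← mul_assoc, ← ht]
  simp only [mul_assoc]

theorem HasSimpleRightSocle.of_idempotentIso {e f : R} (hf : HasSimpleRightSocle f)
    (hff : IsIdempotentElem f) (h : IdempotentIso e f) : HasSimpleRightSocle e :=
  hasSimpleLeftSocle_op.mp ((hasSimpleLeftSocle_op.mpr hf).of_idempotentIso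
    (congrArg MulOpposite.op hff) h.op)

theorem HasSimpleLeftSocle.isLeftMinimal {e a : R} (h : HasSimpleLeftSocle e) (hae : a * e = a)
    (ha : a ≠ 0) (haJ : ∀ j ∈ Ring.jacobson R, j * a = 0) : IsLeftMinimal a :=
  ⟨ha, fun s hs ↦ h _ _ (by rw [mul_assoc, hae]) hs
    (fun j hj ↦ by rw [← mul_assoc]; exact haJ _ (jacobson_mul_mem_right s hj)) hae haJ⟩

theorem hasSimpleLeftSocle_of_isSimpleModule [IsSemisimpleRing (R ⧸ Ring.jacobson R)] {e : R}
    (he : IsIdempotentElem e) (h : IsSimpleModule R (moduleSocle R (principalLeft e))) :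
    HasSimpleLeftSocle e := by
  intro a b ha ha0 haJ hb hbJ
  have mem : ∀ x (hx : x * e = x), (∀ j ∈ Ring.jacobson R, j * x = 0) →
      (⟨x, he.mem_principalLeft.mpr hx⟩ : principalLeft e) ∈ moduleSocle R (principalLeft e) :=
    fun x hx hxJ ↦ mem_moduleSocle_iff.mpr fun j hj ↦ Subtype.ext (hxJ j hj)
  obtain ⟨t, ht⟩ := IsSimpleModule.toSpanSingleton_surjective R
    (m := (⟨_, mem a ha haJ⟩ : moduleSocle R (principalLeft e)))
    (fun h0 ↦ ha0 (congrArg (fun x ↦ (x.1 : R)) h0)) ⟨_, mem b hb hbJ⟩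
  exact ⟨t, congrArg (fun x ↦ (x.1 : R)) ht⟩

/-- If `c ∈ eRf` and `Rc` is the (simple) socle of `Rf`, then right multiplication by `c`
identifies the top of `Re` with the socle of `Rf`. -/
theorem nonempty_socle_equiv_top [IsSemisimpleRing (R ⧸ Ring.jacobson R)] {e f c : R}
    (he : IsCornerLocal e) (hf : IsIdempotentElem f) (hec : e * c = c) (hcf : c * f = c)
    (hc : IsLeftMinimal c)
    (hsoc : ∀ a, a * f = a → (∀ j ∈ Ring.jacobson R, j * a = 0) → ∃ t, a = t * c) :
    Nonempty (moduleSocle R (principalLeft f) ≃ₗ[R] ModuleTop R (principalLeft e)) := by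
  let g (x : R) : principalLeft f :=
    ⟨x * c, hf.mem_principalLeft.mpr (by rw [mul_assoc, hcf])⟩
  have hg : ∀ x, g x ∈ moduleSocle R (principalLeft f) := fun x ↦
    mem_moduleSocle_iff.mpr fun j hj ↦ Subtype.ext <| by
      change j * (x * c) = 0
      rw [← mul_assoc]
      exact hc.jacobson_mul_eq_zero (jacobson_mul_mem_right x hj)
  have hgs : ∀ y : moduleSocle R (principalLeft f), ∃ x, y = ⟨g x, hg x⟩ := fun y ↦ by
    obtain ⟨t, ht⟩ := hsoc y.1 (hf.mem_principalLeft.mp y.1.2)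
      fun j hj ↦ congrArg Subtype.val (mem_moduleSocle_iff.mp y.2 j hj)
    exact ⟨t, Subtype.ext (Subtype.ext ht)⟩
  have hsimple : IsSimpleModule R (moduleSocle R (principalLeft f)) := by
    refine isSimpleModule_iff_toSpanSingleton_surjective.mpr ⟨⟨⟨g 1, hg 1⟩, 0, fun h0 ↦ hc.1 ?_⟩,
      fun x hx y ↦ ?_⟩
    · exact (one_mul c).symm.trans (congrArg (fun x ↦ (x.1 : R)) h0)
    · obtain ⟨s, rfl⟩ := hgs x
      obtain ⟨r, rfl⟩ := hgs y
      obtain ⟨t, ht⟩ := hc.2 s fun h0 ↦ hx (Subtype.ext (Subtype.ext h0))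
      refine ⟨r * t, Subtype.ext (Subtype.ext ?_)⟩
      change r * t * (s * c) = r * c
      rw [mul_assoc, ht]
  let φ : principalLeft e →ₗ[R] moduleSocle R (principalLeft f) :=
    { toFun := fun x ↦ ⟨g x, hg x⟩
      map_add' := fun x y ↦ Subtype.ext (Subtype.ext (add_mul (x : R) y c))
      map_smul' := fun r x ↦ Subtype.ext (Subtype.ext (mul_assoc r (x : R) c)) }
  obtain ⟨ψ⟩ := he.nonempty_top_equiv (f := φ) fun y ↦ by
    obtain ⟨x, rfl⟩ := hgs y
    refine ⟨⟨x * e, mem_principalLeft.mpr ⟨x, rfl⟩⟩, Subtype.ext (Subtype.ext ?_)⟩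
    change x * e * c = x * c
    rw [mul_assoc, hec]
  exact ⟨ψ.symm⟩

end SimpleSocle

/-! ### Principal right ideals as left modules over the opposite ring -/

section PrincipalOpposite

variable {R : Type u} [Ring R]

/-- The right module `aR` is the left module `Rᵐᵒᵖ a`. -/
def principalRightEquiv (a : R) : principalRight a ≃ₗ[Rᵐᵒᵖ] principalLeft (op a) :=
  ((opModuleEquiv R).submoduleMap (principalRight a)).trans <| LinearEquiv.ofEq _ _ <| by
    rw [principalRight, Submodule.map_span, Set.image_singleton]
    rfl

theorem nonempty_right_socle_equiv_top [hss : IsSemisimpleRing (R ⧸ Ring.jacobson R)] {e f c : R}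
    (he : IsCornerLocal e) (hf : IsIdempotentElem f) (hce : c * e = c) (hfc : f * c = c)
    (hc : IsRightMinimal c)
    (hsoc : ∀ a, f * a = a → (∀ j ∈ Ring.jacobson R, a * j = 0) → ∃ t, a = c * t) :
    Nonempty (moduleSocle Rᵐᵒᵖ (principalRight f) ≃ₗ[Rᵐᵒᵖ]
      ModuleTop Rᵐᵒᵖ (principalRight e)) := by
  have := isSemisimpleRing_op_quotient_jacobson hss
  obtain ⟨φ⟩ := nonempty_socle_equiv_top he.op (congrArg op hf) (congrArg op hce)
    (congrArg op hfc) (isLeftMinimal_op.mpr hc) fun a ha haJ ↦ by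
      obtain ⟨a, rfl⟩ := op_surjective a
      obtain ⟨t, ht⟩ := hsoc a (op_injective ha)
        fun j hj ↦ op_injective (haJ (op j) (op_mem_jacobson.mpr hj))
      exact ⟨op t, congrArg op ht⟩
  obtain ⟨α⟩ := (principalRightEquiv f).nonempty_moduleSocle_equiv
  obtain ⟨β⟩ := (principalRightEquiv e).nonempty_moduleTop_equiv
  exact ⟨(α.trans φ).trans β.symm⟩

theorem IsCornerLocal.isSimpleModule_top_right {e : R} (h : IsCornerLocal e) :
    IsSimpleModule Rᵐᵒᵖ (ModuleTop Rᵐᵒᵖ (principalRight e)) := by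
  obtain ⟨φ⟩ := (principalRightEquiv e).nonempty_moduleTop_equiv
  have := h.op.isSimpleModule_top
  exact .congr φ

theorem hasSimpleRightSocle_of_isSimpleModule [hss : IsSemisimpleRing (R ⧸ Ring.jacobson R)]
    {e : R} (he : IsIdempotentElem e)
    (h : IsSimpleModule Rᵐᵒᵖ (moduleSocle Rᵐᵒᵖ (principalRight e))) : HasSimpleRightSocle e := by
  have := isSemisimpleRing_op_quotient_jacobson hss
  obtain ⟨φ⟩ := (principalRightEquiv e).nonempty_moduleSocle_equiv
  exact hasSimpleLeftSocle_op.mp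
    (hasSimpleLeftSocle_of_isSimpleModule (congrArg op he) (φ.isSimpleModule_iff.mp h))

theorem exists_nonempty_right_top_equiv {n m : ℕ} {ε : Fin m → R} {e : Fin n → R}
    (hε : ∑ j, ε j = 1) (he : ∀ k, IsCornerLocal (e k))
    (hεe : ∀ j, ∃ k, IdempotentIso (ε j) (e k)) (T : Type*) [AddCommGroup T] [Module Rᵐᵒᵖ T]
    [IsSimpleModule Rᵐᵒᵖ T] :
    ∃ k, Nonempty (ModuleTop Rᵐᵒᵖ (principalRight (e k)) ≃ₗ[Rᵐᵒᵖ] T) := by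
  obtain ⟨k, ⟨φ⟩⟩ := exists_nonempty_top_equiv (ε := fun j ↦ op (ε j)) (e := fun k ↦ op (e k))
    (by rw [← Finset.op_sum, hε, op_one]) (fun k ↦ (he k).op)
    (fun j ↦ (hεe j).imp fun k h ↦ h.op) T
  obtain ⟨α⟩ := (principalRightEquiv (e k)).nonempty_moduleTop_equiv
  exact ⟨k, ⟨α.trans φ⟩⟩

end PrincipalOpposite

/-! ### Nakayama permutations -/

section Nakayama

variable {R : Type u} [Ring R]

/-- The socle of a submodule `N`, defined inside `N`, embeds into the ambient module. -/
theorem exists_submodule_equiv_of_socle {A M : Type*} [Ring A] [AddCommGroup M] [Module A M]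
    (N : Submodule A M) : ∃ I : Submodule A M, Nonempty (moduleSocle A N ≃ₗ[A] I) :=
  ⟨_, ⟨Submodule.equivMapOfInjective N.subtype N.injective_subtype _⟩⟩

/-- If the socles of all `εⱼR` and `Rεⱼ` are simple and the two socles of `R` coincide, every
simple right ideal `aR` is a D-ideal. Indeed `Ra` is simple; pick `εᵢ` with `εᵢa ≠ 0`, so that
`R = l(a) + Rεᵢ`. For `z ∈ rl(aR)` both `εᵢa` and `εᵢz` lie in the socle of `εᵢR`, hence
`εᵢz = εᵢat` for some `t`, and `z - at` is annihilated by `l(a)` and by `εᵢ`. -/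
theorem isRightMinannihilator_of_hasSimpleSocle {m : ℕ} {ε : Fin m → R} (hε : ∑ j, ε j = 1)
    (hidem : ∀ j, IsIdempotentElem (ε j)) (hl : ∀ j, HasSimpleLeftSocle (ε j))
    (hr : ∀ j, HasSimpleRightSocle (ε j))
    (hS : ∀ x : R, (∀ j ∈ Ring.jacobson R, j * x = 0) ↔ ∀ j ∈ Ring.jacobson R, x * j = 0) :
    IsRightMinannihilator R := by
  intro a ha z hz
  have haJ : ∀ j ∈ Ring.jacobson R, a * j = 0 := fun j ↦ ha.mul_jacobson_eq_zero
  have hJa := (hS a).mpr haJ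
  have hzJ := (hS z).mp fun j hj ↦ hz j (hJa j hj)
  have haL : IsLeftMinimal a := by
    obtain ⟨j, hj⟩ := exists_mul_ne_zero_of_sum_eq_one hε ha.1
    obtain ⟨t, ht⟩ := ha.2 _ hj
    refine IsLeftMinimal.of_mul_right ((hl j).isLeftMinimal ?_ hj fun i hi ↦ ?_) ht
    · rw [mul_assoc, (hidem j).eq]
    · rw [← mul_assoc, hJa i hi, zero_mul]
  obtain ⟨i, hi⟩ : ∃ i, ε i * a ≠ 0 := exists_smul_ne_zero_of_sum_eq_one hε ha.1
  obtain ⟨t, ht⟩ := hr i (ε i * a) (ε i * z) (by rw [← mul_assoc, (hidem i).eq]) hi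
    (fun j hj ↦ by rw [mul_assoc, haJ j hj, mul_zero]) (by rw [← mul_assoc, (hidem i).eq])
    (fun j hj ↦ by rw [mul_assoc, hzJ j hj, mul_zero])
  obtain ⟨s, hs⟩ := haL.2 _ hi
  refine ⟨t, ?_⟩
  -- `1 - s * ε i` annihilates `a`, hence also `z`.
  have h1 : (1 - s * ε i) * z = 0 := hz _ (by rw [sub_mul, one_mul, mul_assoc, hs, sub_self])
  rw [sub_mul, one_mul, sub_eq_zero] at h1
  rw [h1, mul_assoc, ← ht, ← mul_assoc, hs]

theorem isLeftMinannihilator_of_hasSimpleSocle {m : ℕ} {ε : Fin m → R} (hε : ∑ j, ε j = 1)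
    (hidem : ∀ j, IsIdempotentElem (ε j)) (hl : ∀ j, HasSimpleLeftSocle (ε j))
    (hr : ∀ j, HasSimpleRightSocle (ε j))
    (hS : ∀ x : R, (∀ j ∈ Ring.jacobson R, j * x = 0) ↔ ∀ j ∈ Ring.jacobson R, x * j = 0) :
    IsLeftMinannihilator R := by
  refine isRightMinannihilator_op.mp (isRightMinannihilator_of_hasSimpleSocle
    (ε := fun j ↦ op (ε j)) (by rw [← Finset.op_sum, hε, op_one])
    (fun j ↦ congrArg op (hidem j)) (fun j ↦ hasSimpleLeftSocle_op.mpr (hr j))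
    (fun j ↦ hasSimpleRightSocle_op.mpr (hl j)) ?_)
  simpa only [MulOpposite.forall, ← op_mul, op_eq_zero_iff, op_mem_jacobson] using
    fun x ↦ (hS x).symm

/-- In a left Kasch, right minannihilator ring the socle of `eR`, for a local idempotent `e`, is a
simple right ideal `aR`, namely the right annihilator of the maximal left ideal `{x | xe ∈ J}`. -/
theorem IsCornerLocal.exists_socle_generator (hK : HasMaximalLeftAnnihilators R)
    (hM : IsRightMinannihilator R) (hlr : ∀ a : R, IsLeftMinimal a → IsRightMinimal a) {e : R}
    (he : IsCornerLocal e) : ∃ a, IsRightMinimal a ∧ e * a = a ∧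
      ∀ b, e * b = b → (∀ j ∈ Ring.jacobson R, j * b = 0) → ∃ t, b = a * t := by
  let L : Ideal R := Submodule.comap (LinearMap.toSpanSingleton R R e) (Ring.jacobson R)
  have hL : ∀ x, x ∈ L ↔ x * e ∈ Ring.jacobson R := fun _ ↦ Iff.rfl
  have hLmax : L.IsMaximal := by
    refine Ideal.isMaximal_iff.mpr ⟨fun h1 ↦ he.notMem ?_, fun K y hLK hyL hyK ↦ ?_⟩
    · rwa [hL, one_mul] at h1
    · rw [hL] at hyL
      obtain ⟨t, ht⟩ := he.exists_mul_eq (by rw [mul_assoc, he.idem.eq]) hyL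
      have h1 : 1 - t * y ∈ K := hLK <| by
        rw [hL, sub_mul, mul_assoc, ht, one_mul, sub_self]
        exact zero_mem _
      rw [← sub_add_cancel 1 (t * y)]
      exact K.add_mem h1 (K.mul_mem_left t hyK)
  obtain ⟨a, ha, hLa⟩ := hK L hLmax
  have hea : e * a = a := by
    have h1 := hLa (1 - e) <| by
      rw [hL, he.idem.one_sub_mul_self]
      exact zero_mem _
    rw [sub_mul, one_mul, sub_eq_zero] at h1
    exact h1.symm
  have hmin := hlr a (isLeftMinimal_of_isMaximal hLmax ha hLa)
  refine ⟨a, hmin, hea, fun b heb hbJ ↦ hM a hmin b fun x hx ↦ ?_⟩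
  have hxL := hLmax.mem_of_mul_eq_zero ha hLa hx
  rw [← heb, ← mul_assoc]
  exact hbJ _ hxL

/-- In a Kasch minannihilator ring `soc (eₖR)` is simple. It has a generator `b ∈ eₖRe_{π(k)}` for
some index `π(k)`, and then `Rb` is the socle of `Re_{π(k)}`, which gives both Nakayama
isomorphisms. If `π(k) = π(k')`, the generators `b` and `b'` differ by a left factor from
`e_{k'}Reₖ`, which lies outside `J(R)` because `Jb = 0`; hence `eₖ` and `e_{k'}` are isomorphic. -/
theorem nakayama_of_kasch_minannihilator [hss : IsSemisimpleRing (R ⧸ Ring.jacobson R)]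
    {n m : ℕ} {ε : Fin m → R} {e : Fin n → R} (hε : ∑ j, ε j = 1)
    (he : ∀ k, IsCornerLocal (e k)) (hεe : ∀ j, ∃ k, IdempotentIso (ε j) (e k))
    (heq : ∀ k k', IdempotentIso (e k) (e k') → k = k')
    (hR : IsKaschRing R ∧ IsMinannihilatorRing R) :
    (∃ π : Equiv.Perm (Fin n), IsNakayamaPermutation e π) ∧
      (leftSocle R : Set R) = (rightSocle R : Set R) := by
  obtain ⟨hK, hM⟩ := hR
  obtain ⟨hK, hK'⟩ := isKaschRing_iff.mp hK
  obtain ⟨hM, hM'⟩ := isMinannihilatorRing_iff.mp hM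
  have hlr := isLeftMinimal_iff_isRightMinimal hK hK' hM hM'
  have hSS := coe_leftSocle_eq_coe_rightSocle hlr
  have hS : ∀ x : R, (∀ j ∈ Ring.jacobson R, j * x = 0) ↔ ∀ j ∈ Ring.jacobson R, x * j = 0 :=
    fun x ↦ by rw [← mem_leftSocle_iff, ← mem_rightSocle_iff]; exact Set.ext_iff.mp hSS x
  refine ⟨?_, hSS⟩
  -- A generator of `soc (eₖR)` can be chosen in `eₖRe_{π(k)}`.
  have right : ∀ k, ∃ j b, IsRightMinimal b ∧ e k * b = b ∧ b * e j = b ∧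
      ∀ x, e k * x = x → (∀ i ∈ Ring.jacobson R, i * x = 0) → ∃ t, x = b * t := fun k ↦ by
    obtain ⟨a, ha, hka, hsoc⟩ := (he k).exists_socle_generator hK hM' fun a ↦ (hlr a).mp
    obtain ⟨i, hi⟩ := exists_mul_ne_zero_of_sum_eq_one hε ha.1
    obtain ⟨j, u, v, hu, -, huv, -⟩ := hεe i
    have hau : a * u ≠ 0 := fun h0 ↦ hi (by rw [← huv, ← mul_assoc, h0, zero_mul])
    refine ⟨j, a * u, ha.mul_right hau, by rw [← mul_assoc, hka], ?_, fun x hx hxJ ↦ ?_⟩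
    · rw [mul_assoc, ← hu, mul_assoc _ (e j), (he j).idem.eq]
    · obtain ⟨t, ht⟩ := ha.2 u hau
      obtain ⟨s, hs⟩ := hsoc x hx hxJ
      exact ⟨t * s, by rw [← mul_assoc, ht, hs]⟩
  have left : ∀ j, ∃ c, IsLeftMinimal c ∧
      ∀ x, x * e j = x → (∀ i ∈ Ring.jacobson R, x * i = 0) → ∃ t, x = t * c := fun j ↦ by
    obtain ⟨c, hc, -, hsoc⟩ := (he j).op.exists_socle_generator hK'
      (isRightMinannihilator_op.mpr hM) fun a ↦ by
        obtain ⟨a, rfl⟩ := op_surjective a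
        rw [isLeftMinimal_op, isRightMinimal_op]
        exact (hlr a).mpr
    obtain ⟨c, rfl⟩ := op_surjective c
    refine ⟨c, isRightMinimal_op.mp hc, fun x hx hxJ ↦ ?_⟩
    obtain ⟨t, ht⟩ := hsoc (op x) (congrArg op hx) fun i hi ↦ by
      obtain ⟨i, rfl⟩ := op_surjective i
      exact congrArg op (hxJ i (op_mem_jacobson.mp hi))
    exact ⟨unop t, op_injective ht⟩
  choose π b hb hkb hbj hsoc using right
  have hleft : ∀ k x, x * e (π k) = x → (∀ i ∈ Ring.jacobson R, x * i = 0) → ∃ t, x = t * b k := by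
    intro k x hx hxJ
    obtain ⟨c, hc, hcsoc⟩ := left (π k)
    obtain ⟨s, hs⟩ := hcsoc (b k) (hbj k) fun i ↦ (hb k).mul_jacobson_eq_zero
    obtain ⟨t, ht⟩ := hc.2 s (hs ▸ (hb k).1)
    obtain ⟨r, hr⟩ := hcsoc x hx hxJ
    exact ⟨r * t, by rw [hs, mul_assoc, ht, hr]⟩
  have hinj : Function.Injective π := by
    intro k k' hkk'
    obtain ⟨t, ht⟩ := hleft k (b k') (by rw [hkk', hbj]) fun i ↦ (hb k').mul_jacobson_eq_zero
    refine (heq k' k ((he k').idempotentIso (he k) (x := e k' * t * e k) ?_ fun hJ ↦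
      (hb k').1 ?_)).symm
    · rw [← mul_assoc, ← mul_assoc, (he k').idem.eq, mul_assoc, (he k).idem.eq]
    · have h0 := ((hlr _).mpr (hb k)).jacobson_mul_eq_zero hJ
      rwa [mul_assoc, hkb, mul_assoc, ← ht, hkb] at h0
  refine ⟨Equiv.ofBijective π (Finite.injective_iff_bijective.mp hinj), fun k ↦ ⟨?_, ?_⟩⟩
  · exact nonempty_right_socle_equiv_top (he (π k)) (he k).idem (hbj k) (hkb k) (hb k)
      fun x hx hxJ ↦ hsoc k x hx ((hS x).mpr hxJ)
  · exact nonempty_socle_equiv_top (he k) (he (π k)).idem (hkb k) (hbj k) ((hlr _).mpr (hb k))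
      fun x hx hxJ ↦ hleft k x hx ((hS x).mp hxJ)

/-- A Nakayama permutation makes the socles of all `eₖR` and `Reₖ` simple, and realizes the top of
each `Reₖ` and `eₖR`, hence every simple module, inside a socle. -/
theorem kasch_minannihilator_of_nakayama [hss : IsSemisimpleRing (R ⧸ Ring.jacobson R)]
    {n m : ℕ} {ε : Fin m → R} {e : Fin n → R} (hε : ∑ j, ε j = 1)
    (hidem : ∀ j, IsIdempotentElem (ε j)) (he : ∀ k, IsCornerLocal (e k))
    (hεe : ∀ j, ∃ k, IdempotentIso (ε j) (e k)) {π : Equiv.Perm (Fin n)}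
    (hπ : IsNakayamaPermutation e π) (hSS : (leftSocle R : Set R) = (rightSocle R : Set R)) :
    IsKaschRing R ∧ IsMinannihilatorRing R := by
  have hS : ∀ x : R, (∀ j ∈ Ring.jacobson R, j * x = 0) ↔ ∀ j ∈ Ring.jacobson R, x * j = 0 :=
    fun x ↦ by rw [← mem_leftSocle_iff, ← mem_rightSocle_iff]; exact Set.ext_iff.mp hSS x
  have hr : ∀ j, HasSimpleRightSocle (ε j) := fun j ↦ by
    obtain ⟨k, hk⟩ := hεe j
    obtain ⟨φ⟩ := (hπ k).1
    have := (he (π k)).isSimpleModule_top_right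
    exact (hasSimpleRightSocle_of_isSimpleModule (he k).idem (.congr φ)).of_idempotentIso
      (he k).idem hk
  have hl : ∀ j, HasSimpleLeftSocle (ε j) := fun j ↦ by
    obtain ⟨k, hk⟩ := hεe j
    obtain ⟨k, rfl⟩ := π.surjective k
    obtain ⟨φ⟩ := (hπ k).2
    have := (he k).isSimpleModule_top
    exact (hasSimpleLeftSocle_of_isSimpleModule (he (π k)).idem (.congr φ)).of_idempotentIso
      (he (π k)).idem hk
  refine ⟨⟨fun T _ _ _ ↦ ?_, fun T _ _ _ ↦ ?_⟩, isMinannihilatorRing_iff.mpr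
    ⟨isLeftMinannihilator_of_hasSimpleSocle hε hidem hl hr hS,
      isRightMinannihilator_of_hasSimpleSocle hε hidem hl hr hS⟩⟩
  · obtain ⟨k, ⟨φ⟩⟩ := exists_nonempty_top_equiv hε he hεe T
    obtain ⟨ψ⟩ := (hπ k).2
    obtain ⟨I, ⟨χ⟩⟩ := exists_submodule_equiv_of_socle (principalLeft (e (π k)))
    exact ⟨I, ⟨φ.symm.trans (ψ.symm.trans χ)⟩⟩
  · obtain ⟨k, ⟨φ⟩⟩ := exists_nonempty_right_top_equiv hε he hεe T
    obtain ⟨k, rfl⟩ := π.surjective k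
    obtain ⟨ψ⟩ := (hπ k).1
    obtain ⟨I, ⟨χ⟩⟩ := exists_submodule_equiv_of_socle (principalRight (e k))
    exact ⟨I, ⟨φ.symm.trans (ψ.symm.trans χ)⟩⟩

end Nakayama

theorem mainTheorem1 (R : Type u) [Ring R] (hR : IsSemiperfectRing R) :
    (∃ (n : ℕ) (e : Fin n → R), IsBasicSet e) ∧
    ∀ (n : ℕ) (e : Fin n → R), IsBasicSet e →
      List.TFAE [
        (∃ π : Equiv.Perm (Fin n), IsNakayamaPermutation e π) ∧
          (leftSocle R : Set R) = (rightSocle R : Set R),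
        IsKaschRing R ∧ IsMinannihilatorRing R,
        SocleAndTopDIdeals R,
        AnnLeftTopRightSocle R ∧ AnnLeftSocleRightTop R] := by
  refine ⟨hR.exists_isBasicSet, fun n e ⟨m, ε, hε, hloc, ⟨ι, hι⟩, hiso⟩ ↦ ?_⟩
  have hss := hR.1
  have he : ∀ k, IsCornerLocal (e k) := fun k ↦ hι k ▸ (hloc (ι k)).isCornerLocal
  have hεe : ∀ j, ∃ k, IdempotentIso (ε j) (e k) := fun j ↦ by
    obtain ⟨k, hk, -⟩ := hiso j
    exact ⟨k, (nonempty_principalRight_equiv_iff (hε.idem j) (he k).idem).mp hk⟩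
  have heq : ∀ k k', IdempotentIso (e k) (e k') → k = k' := fun k k' h ↦ by
    refine (hiso (ι k)).unique ?_ ?_ <;> rw [← hι k]
    · exact ⟨.refl _ _⟩
    · exact (nonempty_principalRight_equiv_iff (he k).idem (he k').idem).mpr h
  tfae_have 1 → 2 := fun ⟨⟨_, hπ⟩, hS⟩ ↦
    kasch_minannihilator_of_nakayama hε.complete hε.idem he hεe hπ hS
  tfae_have 2 → 1 := nakayama_of_kasch_minannihilator hε.complete he hεe heq
  tfae_have 2 ↔ 3 := kasch_minannihilator_iff
  tfae_have 3 ↔ 4 := socleAndTopDIdeals_iff_annihilator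
  tfae_finish
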